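/- **Theorem 1.3.** Let $\{X_i^{(j)}\}_{i,j\ge 1}$ be i.i.d. with $\mathbb P_{1/2}\{X_i^{(j)}=1\}=\mathbb P_{1/2}\{X_i^{(j)}=0\}=\tfrac12$, and, independently of these, let there be independent rate-one Poisson processes, the $i$-th having jump times $0=:J_i^{(0)}<J_i^{(1)}<J_i^{(2)}<\cdots$. For $t\ge 0$ put $$X_i(t):=\sum_{j=1}^\infty X_i^{(j)}\mathbf 1_{\{J_i^{(j-1)}\le t<J_i^{(j)}\}},\qquad S_k(t):=X_1(t)+\cdots+X_k(t).$$ For $s>0$ let $\psi_s(x):=\min(1,|x|^{-s})$ (so $\psi_s(0)=1$). For $F\subset\mathbb R_+$ and $r>0$ let $N_r(F;\psi_s)$ be the supremum of $\sum_{i=1}^n w_i$ over all finite families $(w_i,x_i)_{i=1}^n$ with $x_i\in F$, $w_i\ge 0$ and $\sum_{j=1}^n w_j\psi_s((x_i-x_j)/r)\le 1$ for every $i=1,\dots,n$. Howroyd's $\tfrac12$-dimensional lower and upper box-dimension profiles of $F$ are $$\gamma:=\liminf_{r\downarrow0}\frac{\log N_r(F;\psi_{1/2})}{\log(1/r)},\qquad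 \delta:=\limsup_{r\downarrow0}\frac{\log N_r(F;\psi_{1/2})}{\log(1/r)}\qquad(\log 0:=-\infty).$$ Then for every bounded (nonrandom) set $F\subset\mathbb R_+$, as $k\to\infty$ along the even integers, $$k^{-(1-2\gamma)/2+o(1)}\le\mathbb P_{1/2}\{\exists t\in F:\ S_k(t)=k/2\}\le k^{-(1-2\delta)/2+o(1)},$$ where $k^{-\infty}:=0$ (this is needed only for $F=\varnothing$). Moreover, each of the two bounds is attained along a suitable subsequence: there is a sequence of even integers $k\to\infty$ along which the probability equals $k^{-(1-2\gamma)/2+o(1)}$, and another one along which it equals $k^{-(1-2\delta)/2+o(1)}$. -/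

import Mathlib

open MeasureTheory ProbabilityTheory Filter Topology
open scoped ENNReal

/-! ### Dynamical bit sequences -/

namespace DynBits

/-- The canonical sample space. For `ω = (b, g)`, the number `b (i, j)` is the `j`-th bit used at
site `i`, and `g (i, j)` is the waiting time between the `j`-th and the `(j+1)`-st ring of the
clock at site `i` (sites and bits are numbered from `0`). -/
abbrev Sample : Type := (ℕ × ℕ → ℕ) × (ℕ × ℕ → ℝ)

/-- The law `ℙ_p`: all bits are i.i.d. and equal `1` with probability `p` and `0` with probability
`1 - p`; independently of them, the clocks at the sites are independent rate-one Poisson processes,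
that is, all waiting times are i.i.d. exponential with rate one. -/
noncomputable def law (p : unitInterval) : Measure Sample :=
  (Measure.infinitePi fun _ : ℕ × ℕ => bernoulliMeasure (1 : ℕ) 0 p).prod
    (Measure.infinitePi fun _ : ℕ × ℕ => expMeasure 1)

instance isProbabilityMeasure_law (p : unitInterval) : IsProbabilityMeasure (law p) := by
  have : IsProbabilityMeasure (expMeasure 1) := isProbabilityMeasure_expMeasure one_pos
  unfold law
  infer_instance

/-- The jump times `0 = J_i^{(0)}, J_i^{(1)}, J_i^{(2)}, …` of the clock at site `i`. -/
def jumpTime (i n : ℕ) (ω : Sample) : ℝ := ∑ m ∈ Finset.range n, ω.2 (i, m)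

open Classical in
/-- The bit at site `i` at time `t`: the `j`-th bit of site `i` is in force during the time
interval `[J_i^{(j)}, J_i^{(j+1)})`. -/
noncomputable def bit (i : ℕ) (t : ℝ) (ω : Sample) : ℕ :=
  ∑' j : ℕ, if jumpTime i j ω ≤ t ∧ t < jumpTime i (j + 1) ω then ω.1 (i, j) else 0

/-- `S_k(t)`, the number of ones at time `t` in the dynamical bit sequence of length `k`. -/
noncomputable def S (k : ℕ) (t : ℝ) (ω : Sample) : ℕ := ∑ i ∈ Finset.range k, bit i t ω

/-- The parameter `p = 1/2`. -/
noncomputable def half : unitInterval := ⟨1 / 2, by norm_num, by norm_num⟩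

/-- `ℙ_{1/2} {∃ t ∈ F : S_k(t) = k/2}`; used for even `k` only. -/
noncomputable def hitProb (F : Set ℝ) (k : ℕ) : ℝ≥0∞ :=
  law half {ω | ∃ t ∈ F, S k t ω = k / 2}

end DynBits

/-! ### Box-dimension profiles -/

namespace BoxProfile

open Classical in
/-- The kernel `ψ_s(x) = min(1, |x|^{-s})`, with `ψ_s(0) = 1` since `0^{-s} = ∞`. -/
noncomputable def ψ (s x : ℝ) : ℝ := if x = 0 then 1 else min 1 (|x| ^ (-s))

/-- `(w_i, x_i)_{i < n}` is a size-`r` weighted `ψ_s`-packing of `F`. -/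
def IsPacking (F : Set ℝ) (s r : ℝ) (n : ℕ) (w x : Fin n → ℝ) : Prop :=
  (∀ i, x i ∈ F) ∧ (∀ i, 0 ≤ w i) ∧ ∀ i, ∑ j, w j * ψ s ((x i - x j) / r) ≤ 1

/-- `N_r(F; ψ_s)`, the supremum of the total weights of the size-`r` weighted
`ψ_s`-packings of `F`. -/
noncomputable def N (F : Set ℝ) (s r : ℝ) : ℝ≥0∞ :=
  ⨆ (n : ℕ) (w : Fin n → ℝ) (x : Fin n → ℝ) (_ : IsPacking F s r n w x),
    ENNReal.ofReal (∑ i, w i)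

/-- The `s`-dimensional lower box-dimension profile of `F`; here `log 0 = -∞`. -/
noncomputable def lower (s : ℝ) (F : Set ℝ) : EReal :=
  liminf (fun r : ℝ => ENNReal.log (N F s r) / ((Real.log (1 / r) : ℝ) : EReal)) (𝓝[>] 0)

/-- The `s`-dimensional upper box-dimension profile of `F`; here `log 0 = -∞`. -/
noncomputable def upper (s : ℝ) (F : Set ℝ) : EReal :=
  limsup (fun r : ℝ => ENNReal.log (N F s r) / ((Real.log (1 / r) : ℝ) : EReal)) (𝓝[>] 0)

end BoxProfile

/-! ### Powers with extended real exponents -/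

/-- `k^x` for an integer `k` and an extended real exponent `x`; used for `k ≥ 2` only. The value
`x = -∞` (giving `k^{-∞} = 0`) is there because the box-dimension profiles of the empty set
are `-∞`. -/
noncomputable def powE (k : ℕ) (x : EReal) : ℝ≥0∞ :=
  EReal.exp (x * ((Real.log k : ℝ) : EReal))

/-- For real exponents, `powE` is the usual power. -/
theorem powE_coe {k : ℕ} (hk : 0 < k) (x : ℝ) : powE k x = ENNReal.ofReal ((k : ℝ) ^ x) := by
  have h : (0 : ℝ) < k := by exact_mod_cast hk
  rw [powE, ← EReal.coe_mul, EReal.exp_coe, Real.rpow_def_of_pos h, mul_comm]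

/-! Write `k = 2 * n` and call a time balanced if exactly `n` of the `k` bits are one. Given any
history that ends in a balanced configuration, the chance of being balanced again after a delay `Δ`
depends only on `Δ`. Pairing every one with a zero turns the change in the number of ones into a
lazy symmetric walk of `n` steps, and the chance is its return probability `retProb n ρ` with `ρ =
(1 - exp (-2Δ)) / 2`. For `Δ` in a bounded range this is comparable to `min 1 ((k Δ) ^ (-1/2))`,
which is the kernel `ψ (1/2)` at scale `1 / k`; a fixed time is balanced with probability of order
`k ^ (-1/2)`.

Hence `hitProb F k` is, up to constant factors, `k ^ (-1/2) * N F (1/2) (1/k)`. The lower bound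
(`sum_weights_le_law`) is the second moment method: a packing is precisely a weighting of times
under which the second moment of the weighted number of hits is at most a constant times the first.
The upper bound (`law_biUnion_le`) takes the distribution of the first hit of a finite set `T ⊆ F`.
The Markov property at that hit bounds its `ψ`-energy, and discarding the points of large potential
leaves a packing that keeps half of the mass. Right-continuity of the paths passes from finite sets
to `F` (`hitProb_le`).

After taking logarithms and dividing by `log k` the constants vanish, so the exponent of the hitting
probability is `exponent F (1/k) - 1/2 + o(1)`. Monotonicity of `N` in the scale shows that the
scales `1 / (2 * n)` see the same lower and upper limits as all `r ↓ 0`. -/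

namespace DynBits

/-! ### Return probabilities of lazy walks: Fourier formula and two-sided estimates. -/

/-- The probability that a lazy symmetric walk whose steps are `±1` with probability `ρ / 2` each
is back at the origin after `n` steps, as a Fourier integral. -/
noncomputable def retProb (n : ℕ) (ρ : ℝ) : ℝ :=
  (2 * Real.pi)⁻¹ * ∫ θ in (-Real.pi)..Real.pi, (1 - ρ * (1 - Real.cos θ)) ^ n

theorem integral_exp_int_mul_I (m : ℤ) :
    ∫ θ in (-Real.pi)..Real.pi, Complex.exp (m * Complex.I * θ) =
      if m = 0 then 2 * (Real.pi : ℂ) else 0 := by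
  split_ifs with h
  · subst h
    simp
    ring
  · have hc : (m : ℂ) * Complex.I ≠ 0 := by simp [h]
    rw [integral_exp_mul_complex hc]
    -- The endpoints differ by a full period, so the primitive takes equal values there.
    have : (m : ℂ) * Complex.I * (Real.pi : ℝ) =
        m * Complex.I * ((-Real.pi : ℝ) : ℂ) + m * (2 * Real.pi * Complex.I) := by
      push_cast
      ring
    rw [this, Complex.exp_add, Complex.exp_int_mul_two_pi_mul_I]
    simp

/-- Every site flips independently with probability `q`, starting from `n` ones and `n` zeros. With
`z = exp (iθ)` the generating function of the new number of ones, shifted by `n`, is `(((1 - q) z +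
q) (q z + 1 - q) / z) ^ n`: each pair of a one and a zero contributes a lazy step, whose
characteristic function is `1 - 2q(1 - q)(1 - cos θ)`. Integrating over `θ` extracts the coefficient
of shift zero. -/
theorem sum_prod_flip_eq_retProb {ι : Type*} [Fintype ι] [DecidableEq ι] (n : ℕ) (q : ℝ)
    (c : ι → Bool) (hc : (Finset.univ.filter fun i => c i = true).card = n)
    (hc' : (Finset.univ.filter fun i => ¬ c i = true).card = n) :
    ∑ c' : ι → Bool with (Finset.univ.filter fun i => c' i = true).card = n,
      ∏ i, (if c i = c' i then 1 - q else q) = retProb n (2 * q * (1 - q)) := by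
  have key : ∀ θ : ℝ, ∑ c' : ι → Bool, ((∏ i, (if c i = c' i then 1 - q else q) : ℝ) : ℂ) *
      Complex.exp (((((Finset.univ.filter fun i => c' i = true).card : ℤ) - n : ℤ) : ℂ) *
        Complex.I * θ) = (((1 - 2 * q * (1 - q) * (1 - Real.cos θ)) ^ n : ℝ) : ℂ) := by
    intro θ
    set z : ℂ := Complex.exp (Complex.I * θ) with hz
    have hzz : z * Complex.exp (-(Complex.I * θ)) = 1 := by
      rw [hz, ← Complex.exp_add]
      simp
    have hcos : z + Complex.exp (-(Complex.I * θ)) = 2 * (Real.cos θ : ℂ) := by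
      rw [Complex.ofReal_cos, Complex.cos, hz]
      have : -(θ : ℂ) * Complex.I = -(Complex.I * θ) := by ring
      rw [this, mul_comm (θ : ℂ)]
      ring
    have h1 : ∀ c' : ι → Bool, ((∏ i, (if c i = c' i then 1 - q else q) : ℝ) : ℂ) *
      Complex.exp (((((Finset.univ.filter fun i => c' i = true).card : ℤ) - n : ℤ) : ℂ) *
        Complex.I * θ) = (∏ i, ((if c i = c' i then 1 - (q : ℂ) else q) *
          (if c' i = true then z else 1))) * Complex.exp (-(Complex.I * θ)) ^ n := by
      intro c'
      have hz1 : ∏ i, (if c' i = true then z else 1) =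
          z ^ (Finset.univ.filter fun i => c' i = true).card := by
        rw [Finset.prod_ite, Finset.prod_const, Finset.prod_const_one, mul_one]
      rw [Finset.prod_mul_distrib, hz1,
        mul_assoc (∏ i, (if c i = c' i then 1 - (q : ℂ) else q))]
      congr 1
      · push_cast
        refine Finset.prod_congr rfl fun i _ => ?_
        split_ifs <;> simp
      · rw [hz, ← Complex.exp_nat_mul, ← Complex.exp_nat_mul, ← Complex.exp_add]
        congr 1
        push_cast
        ring
    simp_rw [h1]
    rw [← Finset.sum_mul, ← Fintype.prod_sum (fun i (b : Bool) =>
      (if c i = b then 1 - (q : ℂ) else q) * (if b = true then z else 1))]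
    have h2 : ∀ i, ∑ b : Bool, (if c i = b then 1 - (q : ℂ) else q) * (if b = true then z else 1) =
        if c i = true then (1 - q) * z + q else q * z + (1 - q) := by
      intro i
      rw [Fintype.sum_bool]
      cases c i <;> simp
    simp_rw [h2]
    rw [Finset.prod_ite, Finset.prod_const, Finset.prod_const, hc, hc', ← mul_pow, ← mul_pow]
    push_cast
    congr 1
    set w := Complex.exp (-(Complex.I * θ))
    rw [← Complex.ofReal_cos]
    linear_combination (q * (1 - q) : ℂ) * hcos + (q * (1 - q) * z + q ^ 2 + (1 - q) ^ 2 : ℂ) * hzz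
  have h3 : ((∑ c' : ι → Bool with (Finset.univ.filter fun i => c' i = true).card = n,
      ∏ i, (if c i = c' i then 1 - q else q) : ℝ) : ℂ) =
      ((retProb n (2 * q * (1 - q)) : ℝ) : ℂ) := by
    rw [retProb, Complex.ofReal_mul, ← intervalIntegral.integral_ofReal]
    simp_rw [← key]
    rw [intervalIntegral.integral_finsetSum
      (fun c' _ => by apply Continuous.intervalIntegrable; fun_prop)]
    simp_rw [intervalIntegral.integral_const_mul, integral_exp_int_mul_I]
    rw [Finset.sum_filter, Complex.ofReal_sum, Finset.mul_sum]
    refine Finset.sum_congr rfl fun c' _ => ?_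
    have hpi : (Real.pi : ℂ) ≠ 0 := by exact_mod_cast Real.pi_ne_zero
    by_cases h : (Finset.univ.filter fun i => c' i = true).card = n
    · have h' : ((Finset.univ.filter fun i => c' i = true).card : ℤ) - n = 0 := by omega
      rw [if_pos h, if_pos h']
      push_cast
      field_simp
    · have h' : ¬ ((Finset.univ.filter fun i => c' i = true).card : ℤ) - n = 0 := by omega
      rw [if_neg h, if_neg h']
      simp
  exact_mod_cast h3

theorem retProb_le_one {n : ℕ} {ρ : ℝ} (h0 : 0 ≤ ρ) (h1 : ρ ≤ 1 / 2) : retProb n ρ ≤ 1 := by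
  have : ∫ θ in (-Real.pi)..Real.pi, (1 - ρ * (1 - Real.cos θ)) ^ n ≤
      ∫ θ in (-Real.pi)..Real.pi, (1 : ℝ) := by
    refine intervalIntegral.integral_mono_on (by linarith [Real.pi_pos])
      (Continuous.intervalIntegrable (by fun_prop) _ _) (by simp) fun θ _ => ?_
    have := Real.cos_le_one θ
    have := Real.neg_one_le_cos θ
    exact pow_le_one₀ (by nlinarith) (by nlinarith)
  rw [retProb, inv_mul_le_iff₀ (by positivity [Real.pi_pos])]
  simp at this
  linarith

/-- On `[-π, π]` one has `1 - cos θ ≥ 2 θ² / π²`, so the integrand is dominated by a Gaussian with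
parameter `b = 2 n ρ / π²`, whose full integral is `√(π / b)`. -/
theorem retProb_le_rpow {n : ℕ} {ρ : ℝ} (hn : 0 < n) (h0 : 0 < ρ) (h1 : ρ ≤ 1 / 2) :
    retProb n ρ ≤ (n * ρ) ^ (-(1 / 2) : ℝ) := by
  have hpi := Real.pi_pos
  have hn' : (0 : ℝ) < n := by exact_mod_cast hn
  set b : ℝ := n * ρ * (2 / Real.pi ^ 2) with hb
  have hb0 : 0 < b := by positivity
  have hle : ∫ θ in (-Real.pi)..Real.pi, (1 - ρ * (1 - Real.cos θ)) ^ n ≤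
      ∫ θ in (-Real.pi)..Real.pi, Real.exp (-b * θ ^ 2) := by
    refine intervalIntegral.integral_mono_on (by linarith)
      (Continuous.intervalIntegrable (by fun_prop) _ _)
      (Continuous.intervalIntegrable (by fun_prop) _ _) fun θ hθ => ?_
    have hc1 := Real.cos_le_one θ
    have hc2 := Real.neg_one_le_cos θ
    have hq : Real.cos θ ≤ 1 - 2 / Real.pi ^ 2 * θ ^ 2 :=
      Real.cos_le_one_sub_mul_cos_sq (abs_le.2 hθ)
    calc (1 - ρ * (1 - Real.cos θ)) ^ n ≤ Real.exp (-(ρ * (2 / Real.pi ^ 2 * θ ^ 2))) ^ n := by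
          refine pow_le_pow_left₀ (by nlinarith) ?_ n
          have := Real.add_one_le_exp (-(ρ * (2 / Real.pi ^ 2 * θ ^ 2)))
          nlinarith
      _ = _ := by
          rw [← Real.exp_nat_mul, hb]
          ring_nf
  have hg : ∫ θ in (-Real.pi)..Real.pi, Real.exp (-b * θ ^ 2) ≤ √(Real.pi / b) := by
    rw [← integral_gaussian, intervalIntegral.integral_of_le (by linarith)]
    exact setIntegral_le_integral (integrable_exp_neg_mul_sq hb0)
      (Eventually.of_forall fun _ => (Real.exp_pos _).le)
  have hsq : √(Real.pi / b) ≤ 2 * Real.pi * (n * ρ) ^ (-(1 / 2) : ℝ) := by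
    rw [Real.rpow_neg (by positivity), ← Real.sqrt_eq_rpow]
    rw [Real.sqrt_le_left (by positivity), mul_pow, inv_pow, Real.sq_sqrt (by positivity), hb]
    have h3 := Real.pi_le_four
    field_simp
    nlinarith
  rw [retProb, inv_mul_le_iff₀ (by positivity)]
  linarith

/-- Since `ρ ≤ 1/2` the integrand is nonnegative, and on `[-δ, δ]` Bernoulli's inequality keeps it
above `1 - n ρ δ² / 2 ≥ 1/2`. The window `δ` is left free so that it can later be chosen as the
kernel value itself. -/
theorem le_retProb {n : ℕ} {ρ δ : ℝ} (h0 : 0 ≤ ρ) (h1 : ρ ≤ 1 / 2) (hδ0 : 0 ≤ δ) (hδ1 : δ ≤ 1)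
    (hδ : n * ρ * δ ^ 2 ≤ 1) : δ / (2 * Real.pi) ≤ retProb n ρ := by
  have hpi := Real.pi_pos
  have hpi3 := Real.pi_gt_three
  have hnn : ∀ θ : ℝ, 0 ≤ 1 - ρ * (1 - Real.cos θ) := fun θ => by
    have hc1 := Real.cos_le_one θ
    have hc2 := Real.neg_one_le_cos θ
    nlinarith
  have hsub : ∫ θ in (-δ)..δ, (1 - ρ * (1 - Real.cos θ)) ^ n ≤
      ∫ θ in (-Real.pi)..Real.pi, (1 - ρ * (1 - Real.cos θ)) ^ n := by
    refine intervalIntegral.integral_mono_interval (by linarith) (by linarith) (by linarith)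
      (Eventually.of_forall fun θ => pow_nonneg (hnn θ) n)
      (Continuous.intervalIntegrable (by fun_prop) _ _)
  have hlow : ∫ θ in (-δ)..δ, (1 / 2 : ℝ) ≤ ∫ θ in (-δ)..δ, (1 - ρ * (1 - Real.cos θ)) ^ n := by
    refine intervalIntegral.integral_mono_on (by linarith) (by simp)
      (Continuous.intervalIntegrable (by fun_prop) _ _) fun θ hθ => ?_
    have hθ2 : θ ^ 2 ≤ δ ^ 2 := sq_le_sq' hθ.1 hθ.2
    have hcos := Real.one_sub_sq_div_two_le_cos (x := θ)
    have hc2 := Real.neg_one_le_cos θ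
    have hb := one_add_mul_le_pow (a := -(ρ * (1 - Real.cos θ))) (by nlinarith) n
    have hn : (0 : ℝ) ≤ n := Nat.cast_nonneg n
    have : n * (ρ * (1 - Real.cos θ)) ≤ 1 / 2 := by
      have : n * (ρ * (1 - Real.cos θ)) ≤ n * (ρ * (δ ^ 2 / 2)) := by
        gcongr
        linarith
      linarith
    calc (1 / 2 : ℝ) ≤ 1 + n * -(ρ * (1 - Real.cos θ)) := by linarith
      _ ≤ _ := hb
      _ = _ := by ring
  simp at hlow
  rw [retProb, div_eq_inv_mul]
  gcongr
  linarith

end DynBits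

namespace DynBits

/-! ### Resampling one coordinate of a product measure -/

theorem map_update_infinitePi {ι : Type*} [DecidableEq ι] {X : ι → Type*}
    [∀ i, MeasurableSpace (X i)] (μ : ∀ i, Measure (X i)) [∀ i, IsProbabilityMeasure (μ i)]
    (m : ι) :
    ((Measure.infinitePi μ).prod (μ m)).map (fun p => Function.update p.1 m p.2) =
      Measure.infinitePi μ := by
  have hmeas : Measurable fun p : (∀ i, X i) × X m => Function.update p.1 m p.2 :=
    measurable_update'
  refine Measure.eq_infinitePi μ fun s t ht => ?_
  rw [Measure.map_apply hmeas (MeasurableSet.pi s.countable_toSet fun i _ => ht i)]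
  by_cases hm : m ∈ s
  · have : (fun p : (∀ i, X i) × X m => Function.update p.1 m p.2) ⁻¹' ((s : Set ι).pi t) =
        (((s.erase m : Finset ι) : Set ι).pi t) ×ˢ t m := by
      ext ⟨x, y⟩
      simp only [Set.mem_preimage, Set.mem_pi, Finset.mem_coe, Set.mem_prod, Finset.mem_erase]
      constructor
      · intro h
        exact ⟨fun i hi => by simpa [hi.1] using h i hi.2, by simpa using h m hm⟩
      · rintro ⟨h1, h2⟩ i hi
        by_cases him : i = m
        · subst him
          simpa using h2
        · simpa [him] using h1 i ⟨him, hi⟩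
    rw [this, Measure.prod_prod, Measure.infinitePi_pi μ fun i _ => ht i,
      Finset.prod_erase_mul _ _ hm]
  · have : (fun p : (∀ i, X i) × X m => Function.update p.1 m p.2) ⁻¹' ((s : Set ι).pi t) =
        ((s : Set ι).pi t) ×ˢ Set.univ := by
      ext ⟨x, y⟩
      simp only [Set.mem_preimage, Set.mem_pi, Finset.mem_coe, Set.mem_prod, Set.mem_univ, and_true]
      refine forall₂_congr fun i hi => ?_
      have him : i ≠ m := fun h => hm (h ▸ hi)
      simp [him]
    rw [this, Measure.prod_prod, Measure.infinitePi_pi μ fun i _ => ht i, measure_univ, mul_one]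

theorem infinitePi_apply_eq_lintegral_update {ι : Type*} [DecidableEq ι] {X : ι → Type*}
    [∀ i, MeasurableSpace (X i)] (μ : ∀ i, Measure (X i)) [∀ i, IsProbabilityMeasure (μ i)]
    (m : ι) {K : Set (∀ i, X i)} (hK : MeasurableSet K) :
    Measure.infinitePi μ K =
      ∫⁻ x, μ m {y | Function.update x m y ∈ K} ∂Measure.infinitePi μ := by
  have hmeas : Measurable fun p : (∀ i, X i) × X m => Function.update p.1 m p.2 :=
    measurable_update'
  conv_lhs => rw [← map_update_infinitePi μ m]
  rw [Measure.map_apply hmeas hK, Measure.prod_apply (hmeas hK)]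
  rfl

/-- Conditioning on all coordinates except `m`: neither `A` nor `B` looks at coordinate `m`, so
resampling that coordinate only affects the constraint `x m ∈ B x`. This is the source of both the
fresh bits and the memorylessness below. -/
theorem infinitePi_inter_eq_lintegral {ι : Type*} [DecidableEq ι] {X : ι → Type*}
    [∀ i, MeasurableSpace (X i)] (μ : ∀ i, Measure (X i)) [∀ i, IsProbabilityMeasure (μ i)]
    (m : ι) {A : Set (∀ i, X i)} {B : (∀ i, X i) → Set (X m)}
    (hK : MeasurableSet {x | x ∈ A ∧ x m ∈ B x})
    (hA : ∀ x y, Function.update x m y ∈ A ↔ x ∈ A)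
    (hB : ∀ x y, B (Function.update x m y) = B x) :
    Measure.infinitePi μ {x | x ∈ A ∧ x m ∈ B x} =
      ∫⁻ x, A.indicator (fun x => μ m (B x)) x ∂Measure.infinitePi μ := by
  rw [infinitePi_apply_eq_lintegral_update μ m hK]
  refine lintegral_congr fun x => ?_
  by_cases hx : x ∈ A <;> simp [hA, hB, hx]

/-! ### The exponential and the Bernoulli distribution -/

instance isProbabilityMeasure_expMeasure_one : IsProbabilityMeasure (expMeasure 1) :=
  isProbabilityMeasure_expMeasure one_pos

theorem expMeasure_one_Iic (x : ℝ) :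
    expMeasure 1 (Set.Iic x) = ENNReal.ofReal (if 0 ≤ x then 1 - Real.exp (-x) else 0) := by
  have h := cdf_expMeasure_eq one_pos x
  rw [cdf_eq_real] at h
  rw [← ofReal_measureReal, h]
  simp

theorem expMeasure_one_Ioi {x : ℝ} (hx : 0 ≤ x) :
    expMeasure 1 (Set.Ioi x) = ENNReal.ofReal (Real.exp (-x)) := by
  have h1 : expMeasure 1 (Set.Ioi x) = 1 - expMeasure 1 (Set.Iic x) := by
    rw [← prob_compl_eq_one_sub measurableSet_Iic, Set.compl_Iic]
  rw [h1, expMeasure_one_Iic, if_pos hx, ← ENNReal.ofReal_one, ← ENNReal.ofReal_sub]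
  · congr 1
    ring
  · have : Real.exp (-x) ≤ 1 := Real.exp_le_one_iff.2 (by linarith)
    linarith

theorem expMeasure_one_Iio_zero : expMeasure 1 (Set.Iio 0) = 0 :=
  measure_mono_null Set.Iio_subset_Iic_self (by rw [expMeasure_one_Iic]; simp)

theorem bernoulli_half_eq (c : Bool) :
    bernoulliMeasure (1 : ℕ) 0 half {y | decide (y = 1) = c} = 2⁻¹ := by
  have h1 : ((unitInterval.toNNReal half : NNReal) : ℝ≥0∞) = 2⁻¹ := by
    rw [← ENNReal.coe_two, ← ENNReal.coe_inv two_ne_zero]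
    norm_cast
    ext
    simp [half]
  have h2 : ((unitInterval.toNNReal (unitInterval.symm half) : NNReal) : ℝ≥0∞) = 2⁻¹ := by
    rw [← ENNReal.coe_two, ← ENNReal.coe_inv two_ne_zero]
    norm_cast
    ext
    simp [half]
    norm_num
  classical
  rw [bernoulliMeasure_apply half (MeasurableSet.of_discrete)]
  cases c <;> simp [h1, h2]

/-! ### A single site -/

/-- The bits and the waiting times of a single site. -/
abbrev Site : Type := (ℕ → ℕ) × (ℕ → ℝ)

/-- The law of the bits and the waiting times of a single site for `p = 1/2`. -/
noncomputable def siteLaw : Measure Site :=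
  (Measure.infinitePi fun _ : ℕ => bernoulliMeasure (1 : ℕ) 0 half).prod
    (Measure.infinitePi fun _ : ℕ => expMeasure 1)

instance isProbabilityMeasure_siteLaw : IsProbabilityMeasure siteLaw := by
  unfold siteLaw
  infer_instance

/-- The jump times of the clock with waiting times `g`. -/
def arrival (n : ℕ) (g : ℕ → ℝ) : ℝ := ∑ m ∈ Finset.range n, g m

@[fun_prop]
theorem measurable_arrival (n : ℕ) : Measurable (arrival n) := by
  unfold arrival
  fun_prop

theorem arrival_zero (g : ℕ → ℝ) : arrival 0 g = 0 := by simp [arrival]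

theorem arrival_succ (n : ℕ) (g : ℕ → ℝ) : arrival (n + 1) g = arrival n g + g n :=
  Finset.sum_range_succ _ _

theorem arrival_update {n m : ℕ} (h : n ≤ m) (g : ℕ → ℝ) (y : ℝ) :
    arrival n (Function.update g m y) = arrival n g := by
  refine Finset.sum_congr rfl fun i hi => ?_
  rw [Finset.mem_range] at hi
  rw [Function.update_of_ne (by omega)]

/-- The clock with waiting times `g` has rung exactly `m` times by time `t`. -/
def Rings (m : ℕ) (t : ℝ) (g : ℕ → ℝ) : Prop := arrival m g ≤ t ∧ t < arrival (m + 1) g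

theorem measurableSet_rings (m : ℕ) (t : ℝ) : MeasurableSet {ω : Site | Rings m t ω.2} := by
  have h1 : MeasurableSet {ω : Site | arrival m ω.2 ≤ t} :=
    measurableSet_le (by fun_prop) (by fun_prop)
  have h2 : MeasurableSet {ω : Site | t < arrival (m + 1) ω.2} :=
    measurableSet_lt (by fun_prop) (by fun_prop)
  exact h1.inter h2

/-- The regular configurations of a single site. -/
def GoodSite (ω : Site) : Prop :=
  (∀ j, ω.1 j = 0 ∨ ω.1 j = 1) ∧ (∀ j, 0 ≤ ω.2 j) ∧ ∀ N : ℕ, ∃ m, (N : ℝ) < arrival m ω.2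

theorem arrival_mono {g : ℕ → ℝ} (hg : ∀ j, 0 ≤ g j) : Monotone fun n => arrival n g :=
  monotone_nat_of_le_succ fun n => by
    rw [arrival_succ]
    linarith [hg n]

theorem Rings.mono {g : ℕ → ℝ} (hg : ∀ j, 0 ≤ g j) {m n : ℕ} {s t : ℝ} (hst : s ≤ t)
    (hm : Rings m s g) (hn : Rings n t g) : m ≤ n := by
  by_contra h
  have : arrival (n + 1) g ≤ arrival m g := arrival_mono hg (by omega)
  linarith [hm.1, hn.2]

theorem Rings.unique {g : ℕ → ℝ} (hg : ∀ j, 0 ≤ g j) {m n : ℕ} {t : ℝ}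
    (hm : Rings m t g) (hn : Rings n t g) : m = n :=
  le_antisymm (hm.mono hg le_rfl hn) (hn.mono hg le_rfl hm)

theorem GoodSite.exists_rings {ω : Site} (h : GoodSite ω) {t : ℝ} (ht : 0 ≤ t) :
    ∃ m, Rings m t ω.2 := by
  classical
  obtain ⟨N, hN⟩ := exists_nat_gt t
  have hex : ∃ m, t < arrival m ω.2 := (h.2.2 N).imp fun m hm => hN.trans hm
  have h0 : Nat.find hex ≠ 0 := fun h0 => by
    have := Nat.find_spec hex
    rw [h0, arrival_zero] at this
    linarith
  obtain ⟨m, hm⟩ := Nat.exists_eq_succ_of_ne_zero h0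
  refine ⟨m, not_lt.1 (Nat.find_min hex (by omega)), ?_⟩
  have := Nat.find_spec hex
  rwa [hm] at this

open Classical in
/-- The state of the site at time `t`: whether its bit is `1`. -/
noncomputable def siteState (t : ℝ) (ω : Site) : Bool :=
  decide (∃ m, Rings m t ω.2 ∧ ω.1 m = 1)

@[fun_prop]
theorem measurable_siteState (t : ℝ) : Measurable (siteState t) := by
  refine measurable_to_bool ?_
  have : siteState t ⁻¹' {true} = ⋃ m, {ω : Site | Rings m t ω.2} ∩ {ω | ω.1 m = 1} := by
    ext ω
    simp [siteState]
  rw [this]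
  refine MeasurableSet.iUnion fun m => (measurableSet_rings m t).inter ?_
  exact measurableSet_eq_fun (by fun_prop) (by fun_prop)

theorem GoodSite.siteState_eq {ω : Site} (h : GoodSite ω) {m : ℕ} {t : ℝ} (hm : Rings m t ω.2) :
    siteState t ω = decide (ω.1 m = 1) := by
  unfold siteState
  congr 1
  refine propext ⟨?_, fun h => ⟨m, hm, h⟩⟩
  rintro ⟨n, hn, hb⟩
  rwa [hm.unique h.2.1 hn]

theorem ae_waiting_nonneg :
    ∀ᵐ g ∂(Measure.infinitePi fun _ : ℕ => expMeasure 1), ∀ j, 0 ≤ g j := by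
  refine ae_all_iff.2 fun j => ?_
  have h := (measurePreserving_eval_infinitePi (fun _ : ℕ => expMeasure 1) j).quasiMeasurePreserving
  have h0 : ∀ᵐ y ∂expMeasure 1, 0 ≤ y := by
    rw [ae_iff]
    simp only [not_le]
    exact expMeasure_one_Iio_zero
  exact h.ae h0

/-- If the first `m` waiting times sum to at most `t`, each of them is at most `t`. The bound is
crude, but its geometric decay in `m` rules out explosion. -/
theorem infinitePi_exp_arrival_le (t : ℝ) (m : ℕ) :
    (Measure.infinitePi fun _ : ℕ => expMeasure 1) {g | arrival m g ≤ t} ≤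
      ENNReal.ofReal (1 - Real.exp (-t)) ^ m := by
  rcases lt_or_ge t 0 with ht | ht
  · refine le_of_eq_of_le ?_ zero_le
    refine measure_mono_null_ae (t := ∅) ?_ (measure_empty)
    filter_upwards [ae_waiting_nonneg] with g hg hle
    have : 0 ≤ arrival m g := Finset.sum_nonneg fun i _ => hg i
    have hle' : arrival m g ≤ t := hle
    linarith
  induction m with
  | zero => simpa using prob_le_one
  | succ m ih =>
    calc (Measure.infinitePi fun _ : ℕ => expMeasure 1) {g | arrival (m + 1) g ≤ t}
        ≤ (Measure.infinitePi fun _ : ℕ => expMeasure 1)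
            {g | g ∈ {g | arrival m g ≤ t} ∧ g m ∈ Set.Iic t} := by
          refine measure_mono_ae ?_
          filter_upwards [ae_waiting_nonneg] with g hg hle
          have hle' : arrival (m + 1) g ≤ t := hle
          rw [arrival_succ] at hle'
          have h0 : 0 ≤ arrival m g := Finset.sum_nonneg fun i _ => hg i
          exact ⟨show arrival m g ≤ t by linarith [hg m], show g m ≤ t by linarith⟩
      _ = expMeasure 1 (Set.Iic t) *
            (Measure.infinitePi fun _ : ℕ => expMeasure 1) {g | arrival m g ≤ t} := by
          have hm : MeasurableSet {g : ℕ → ℝ | arrival m g ≤ t} :=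
            measurableSet_le (by fun_prop) (by fun_prop)
          rw [infinitePi_inter_eq_lintegral (fun _ : ℕ => expMeasure 1) m
            (A := {g | arrival m g ≤ t}) (hm.inter ((measurable_pi_apply m) measurableSet_Iic))
            (B := fun _ => Set.Iic t)
            (fun x y => by simp [arrival_update]) (fun _ _ => rfl), lintegral_indicator_const hm]
      _ ≤ _ := by
          rw [pow_succ', expMeasure_one_Iic, if_pos ht]
          gcongr

theorem ae_arrival_unbounded :
    ∀ᵐ g ∂(Measure.infinitePi fun _ : ℕ => expMeasure 1), ∀ N : ℕ, ∃ m, (N : ℝ) < arrival m g := by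
  refine ae_all_iff.2 fun N => ?_
  rw [ae_iff]
  push Not
  refine le_antisymm (ge_of_tendsto' (ENNReal.tendsto_pow_atTop_nhds_zero_of_lt_one
    (r := ENNReal.ofReal (1 - Real.exp (-(N : ℝ)))) ?_) fun m => ?_) zero_le
  · rw [← ENNReal.ofReal_one]
    exact (ENNReal.ofReal_lt_ofReal_iff one_pos).2 (by linarith [Real.exp_pos (-(N : ℝ))])
  · exact (measure_mono (t := {g : ℕ → ℝ | arrival m g ≤ N})
      fun g (hg : ∀ m, arrival m g ≤ N) => hg m).trans
      (infinitePi_exp_arrival_le N m)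

theorem ae_bit_zero_or_one :
    ∀ᵐ b ∂(Measure.infinitePi fun _ : ℕ => bernoulliMeasure (1 : ℕ) 0 half),
      ∀ j, b j = 0 ∨ b j = 1 := by
  refine ae_all_iff.2 fun j => ?_
  have h := (measurePreserving_eval_infinitePi
    (fun _ : ℕ => bernoulliMeasure (1 : ℕ) 0 half) j).quasiMeasurePreserving
  have h0 : ∀ᵐ y ∂bernoulliMeasure (1 : ℕ) 0 half, y = 0 ∨ y = 1 := by
    classical
    rw [ae_iff, bernoulliMeasure_apply half (MeasurableSet.of_discrete)]
    simp
  exact h.ae h0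

theorem ae_goodSite : ∀ᵐ ω ∂siteLaw, GoodSite ω := by
  have h1 := Measure.quasiMeasurePreserving_fst
    (μ := Measure.infinitePi fun _ : ℕ => bernoulliMeasure (1 : ℕ) 0 half)
    (ν := Measure.infinitePi fun _ : ℕ => expMeasure 1)
  have h2 := Measure.quasiMeasurePreserving_snd
    (μ := Measure.infinitePi fun _ : ℕ => bernoulliMeasure (1 : ℕ) 0 half)
    (ν := Measure.infinitePi fun _ : ℕ => expMeasure 1)
  filter_upwards [h1.ae ae_bit_zero_or_one, h2.ae ae_waiting_nonneg, h2.ae ae_arrival_unbounded]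
    with ω ha hb hc using ⟨ha, hb, hc⟩

/-! ### The Markov property of a single site -/

theorem siteLaw_eq_tsum_rings {A : Set Site} (hA : MeasurableSet A) {t : ℝ} (ht : 0 ≤ t) :
    siteLaw A = ∑' m, siteLaw (A ∩ {ω | Rings m t ω.2}) := by
  rw [← measure_iUnion₀]
  · refine measure_congr ?_
    filter_upwards [ae_goodSite] with ω hω
    refine propext ⟨fun h => ?_, fun h => ?_⟩
    · obtain ⟨m, hm⟩ := hω.exists_rings ht
      exact Set.mem_iUnion.2 ⟨m, h, hm⟩
    · obtain ⟨m, hm⟩ := Set.mem_iUnion.1 h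
      exact hm.1
  · intro m n hmn
    refine measure_mono_null_ae (t := ∅) ?_ measure_empty
    filter_upwards [ae_goodSite] with ω hω h
    exact hmn (Rings.unique hω.2.1 h.1.2 h.2.2)
  · exact fun m => (hA.inter (measurableSet_rings m t)).nullMeasurableSet

theorem siteLaw_inter_fresh_bit {A : Set Site} (hA : MeasurableSet A) (n : ℕ)
    (h : ∀ b g y, ((Function.update b n y, g) : Site) ∈ A ↔ (b, g) ∈ A) (c : Bool) :
    siteLaw (A ∩ {ω | decide (ω.1 n = 1) = c}) = siteLaw A * 2⁻¹ := by
  have hb : MeasurableSet {ω : Site | decide (ω.1 n = 1) = c} := by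
    have hm : Measurable fun ω : Site => ω.1 n := by fun_prop
    exact hm (MeasurableSet.of_discrete (s := {y | decide (y = 1) = c}))
  rw [siteLaw, Measure.prod_apply_symm (hA.inter hb), Measure.prod_apply_symm hA,
    ← lintegral_mul_const _ (measurable_measure_prodMk_right hA)]
  refine lintegral_congr fun g => ?_
  have hsec : MeasurableSet ((fun b => ((b, g) : Site)) ⁻¹' A) := measurable_prodMk_right hA
  have := infinitePi_inter_eq_lintegral (fun _ : ℕ => bernoulliMeasure (1 : ℕ) 0 half) n
    (A := (fun b => ((b, g) : Site)) ⁻¹' A) (B := fun _ => {y | decide (y = 1) = c})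
    (hsec.inter ((measurable_pi_apply n)
      (MeasurableSet.of_discrete (s := {y | decide (y = 1) = c}))))
    (fun x y => h x g y) (fun _ _ => rfl)
  rw [lintegral_indicator_const hsec, bernoulli_half_eq, mul_comm] at this
  exact this

/-- Memorylessness. With everything but waiting time `m` frozen, the event `u < arrival (m + 1)` has
probability `exp (-(u - arrival m))` for every `u ≥ s`, because `arrival m ≤ s` on `A`. The ratio
between `u = t` and `u = s` is the constant `exp (-(t - s))`. -/
theorem siteLaw_inter_tail {A : Set Site} (hA : MeasurableSet A) (m : ℕ) {s t : ℝ} (hst : s ≤ t)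
    (h : ∀ b g y, ((b, Function.update g m y) : Site) ∈ A ↔ (b, g) ∈ A)
    (hs : ∀ ω ∈ A, arrival m ω.2 ≤ s) :
    siteLaw (A ∩ {ω | t < arrival (m + 1) ω.2}) =
      siteLaw (A ∩ {ω | s < arrival (m + 1) ω.2}) * ENNReal.ofReal (Real.exp (-(t - s))) := by
  have hmt : ∀ t : ℝ, MeasurableSet {ω : Site | t < arrival (m + 1) ω.2} := fun t =>
    measurableSet_lt (by fun_prop) (by fun_prop)
  rw [siteLaw, Measure.prod_apply (hA.inter (hmt t)), Measure.prod_apply (hA.inter (hmt s)),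
    ← lintegral_mul_const _ (measurable_measure_prodMk_left (hA.inter (hmt s)))]
  refine lintegral_congr fun b => ?_
  have hsec : MeasurableSet (Prod.mk b ⁻¹' A) := measurable_prodMk_left hA
  have key : ∀ u, s ≤ u → (Measure.infinitePi fun _ : ℕ => expMeasure 1)
      (Prod.mk b ⁻¹' (A ∩ {ω | u < arrival (m + 1) ω.2})) =
      ∫⁻ g, (Prod.mk b ⁻¹' A).indicator
        (fun g => ENNReal.ofReal (Real.exp (-(u - arrival m g)))) g
          ∂(Measure.infinitePi fun _ : ℕ => expMeasure 1) := by
    intro u hu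
    have hset : Prod.mk b ⁻¹' (A ∩ {ω | u < arrival (m + 1) ω.2}) =
        {g | g ∈ Prod.mk b ⁻¹' A ∧ g m ∈ Set.Ioi (u - arrival m g)} := by
      ext g
      simp [arrival_succ, sub_lt_iff_lt_add']
    rw [hset, infinitePi_inter_eq_lintegral (fun _ : ℕ => expMeasure 1) m
      (A := Prod.mk b ⁻¹' A) (B := fun g => Set.Ioi (u - arrival m g))
      (by rw [← hset]; exact measurable_prodMk_left (hA.inter (hmt u))) (fun x y => h b x y)
      (fun x y => by simp [arrival_update])]
    refine lintegral_congr fun g => ?_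
    by_cases hg : g ∈ Prod.mk b ⁻¹' A
    · rw [Set.indicator_of_mem hg, Set.indicator_of_mem hg, expMeasure_one_Ioi]
      have : arrival m g ≤ s := hs _ hg
      linarith
    · rw [Set.indicator_of_notMem hg, Set.indicator_of_notMem hg]
  rw [key t hst, key s le_rfl, ← lintegral_mul_const _ (by
    refine Measurable.indicator ?_ hsec
    fun_prop)]
  refine lintegral_congr fun g => ?_
  by_cases hg : g ∈ Prod.mk b ⁻¹' A
  · rw [Set.indicator_of_mem hg, Set.indicator_of_mem hg, ← ENNReal.ofReal_mul (Real.exp_pos _).le,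
      ← Real.exp_add]
    congr 2
    ring
  · rw [Set.indicator_of_notMem hg, Set.indicator_of_notMem hg, zero_mul]

open Classical in
/-- The state of the site at time `u`, computed from the first `m + 1` bits and the first `m`
waiting times; this is correct for `u ≤ s` if the clock has rung `m` times by time `s`. -/
noncomputable def stateUpTo (m : ℕ) (u : ℝ) (ω : Site) : Bool :=
  decide ((∃ j < m, Rings j u ω.2 ∧ ω.1 j = 1) ∨ (arrival m ω.2 ≤ u ∧ ω.1 m = 1))

theorem measurable_stateUpTo (m : ℕ) (u : ℝ) : Measurable (stateUpTo m u) := by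
  refine measurable_to_bool ?_
  have : stateUpTo m u ⁻¹' {true} = (⋃ j, ⋃ _ : j < m, {ω : Site | Rings j u ω.2} ∩
      {ω | ω.1 j = 1}) ∪ {ω | arrival m ω.2 ≤ u} ∩ {ω | ω.1 m = 1} := by
    ext ω
    simp [stateUpTo, and_left_comm]
  rw [this]
  have hb : ∀ j, MeasurableSet {ω : Site | ω.1 j = 1} := fun j =>
    measurableSet_eq_fun (by fun_prop) (by fun_prop)
  exact (MeasurableSet.iUnion fun j => MeasurableSet.iUnion fun _ =>
    (measurableSet_rings j u).inter (hb j)).union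
      ((measurableSet_le (by fun_prop) (by fun_prop)).inter (hb m))

/-- The condition `u < arrival (m + 1)` may be dropped, since it follows from `u ≤ s`. Dropping it
makes the history a function of data that involve neither waiting time `m` nor any bit after the
`m`-th, which the independence lemmas require. -/
theorem siteState_eq_stateUpTo {ω : Site} (hω : GoodSite ω) {m : ℕ} {u s : ℝ} (hus : u ≤ s)
    (hm : Rings m s ω.2) : siteState u ω = stateUpTo m u ω := by
  unfold siteState stateUpTo
  congr 1
  refine propext ⟨?_, ?_⟩
  · rintro ⟨j, hj, hb⟩
    rcases (hj.mono hω.2.1 hus hm).lt_or_eq with h | h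
    · exact Or.inl ⟨j, h, hj, hb⟩
    · subst h
      exact Or.inr ⟨hj.1, hb⟩
  · rintro (⟨j, -, hj, hb⟩ | ⟨h, hb⟩)
    · exact ⟨j, hj, hb⟩
    · exact ⟨m, ⟨h, hus.trans_lt hm.2⟩, hb⟩

theorem stateUpTo_update_waiting (m : ℕ) (u : ℝ) (b : ℕ → ℕ) (g : ℕ → ℝ) (y : ℝ) {n : ℕ}
    (hn : m ≤ n) : stateUpTo m u (b, Function.update g n y) = stateUpTo m u (b, g) := by
  unfold stateUpTo Rings
  simp only [arrival_update hn]
  congr 2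
  refine propext (exists_congr fun j => and_congr_right fun hj => ?_)
  rw [arrival_update (by omega), arrival_update (by omega)]

theorem stateUpTo_update_bit (m : ℕ) (u : ℝ) (b : ℕ → ℕ) (g : ℕ → ℝ) (y : ℕ) {n : ℕ}
    (hn : m < n) : stateUpTo m u (Function.update b n y, g) = stateUpTo m u (b, g) := by
  unfold stateUpTo
  refine decide_eq_decide.2 (or_congr (exists_congr fun j => and_congr_right fun hj => ?_) ?_)
  · simp only
    rw [Function.update_of_ne (by omega)]
  · simp only
    rw [Function.update_of_ne hn.ne]

/-- The transition function of a single site. -/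
noncomputable def trans (Δ : ℝ) (a c : Bool) : ℝ :=
  if a = c then 1 - (1 - Real.exp (-Δ)) / 2 else (1 - Real.exp (-Δ)) / 2

/-- Given the number `m` of rings, the bit in force is bit `m`, which is independent of the clock.
-/
theorem siteLaw_siteState {s : ℝ} (hs : 0 ≤ s) (c : Bool) :
    siteLaw {ω | siteState s ω = c} = 2⁻¹ := by
  have hms : MeasurableSet {ω | siteState s ω = c} :=
    (measurable_siteState s) (measurableSet_singleton c)
  rw [siteLaw_eq_tsum_rings hms hs, ← one_mul (2⁻¹ : ℝ≥0∞), ← measure_univ (μ := siteLaw),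
    siteLaw_eq_tsum_rings MeasurableSet.univ hs, ← ENNReal.tsum_mul_right]
  refine tsum_congr fun m => ?_
  rw [Set.univ_inter, ← siteLaw_inter_fresh_bit (measurableSet_rings m s) m (fun _ _ _ => Iff.rfl) c]
  refine measure_congr ?_
  filter_upwards [ae_goodSite] with ω hω
  refine propext ⟨fun h => ⟨h.2, ?_⟩, fun h => ⟨?_, h.1⟩⟩
  · exact (hω.siteState_eq h.2).symm.trans h.1
  · exact (hω.siteState_eq h.1).trans h.2

/-- Split according to the numbers `m` and `n` of rings by times `s` and `t`. The case `n = m` has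
conditional probability `exp (-(t - s))` and keeps the state; for `n > m` the bit in force at `t` is
fresh and fair; `n < m` is null. Summing over `n` gives `trans`. -/
theorem siteLaw_markov (T : Finset ℝ) (a : ℝ → Bool) {s t : ℝ} (hs : 0 ≤ s) (hst : s ≤ t)
    (hsT : s ∈ T) (hT : ∀ u ∈ T, u ≤ s) (c : Bool) :
    siteLaw ({ω | ∀ u ∈ T, siteState u ω = a u} ∩ {ω | siteState t ω = c}) =
      siteLaw {ω | ∀ u ∈ T, siteState u ω = a u} * ENNReal.ofReal (trans (t - s) (a s) c) := by
  have hmeas : ∀ f : ℝ → Site → Bool, (∀ u, Measurable (f u)) →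
      MeasurableSet {ω | ∀ u ∈ T, f u ω = a u} := fun f hf => by
    have : {ω | ∀ u ∈ T, f u ω = a u} = ⋂ u ∈ T, f u ⁻¹' {a u} := by
      ext
      simp
    rw [this]
    exact Finset.measurableSet_biInter T fun u _ => hf u (measurableSet_singleton _)
  set H : Set Site := {ω | ∀ u ∈ T, siteState u ω = a u} with hH
  have hHm : MeasurableSet H := hmeas _ measurable_siteState
  have hXm : MeasurableSet {ω | siteState t ω = c} :=
    (measurable_siteState t) (measurableSet_singleton c)
  rw [siteLaw_eq_tsum_rings (hHm.inter hXm) hs, siteLaw_eq_tsum_rings hHm hs,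
    ← ENNReal.tsum_mul_right]
  refine tsum_congr fun m => ?_
  have hRs := measurableSet_rings m s
  set e : ℝ := Real.exp (-(t - s)) with he
  have he0 : 0 < e := Real.exp_pos _
  have he1 : e ≤ 1 := Real.exp_le_one_iff.2 (by linarith)
  -- `A` records the history without using waiting time `m`; intersecting it with `s < arrival (m +
  -- 1)` gives back `m` rings by time `s`.
  set A : Set Site := {ω | ∀ u ∈ T, stateUpTo m u ω = a u} ∩ {ω | arrival m ω.2 ≤ s} with hA
  have hAm : MeasurableSet A := (hmeas _ (measurable_stateUpTo m)).inter
    (measurableSet_le (by fun_prop) (by fun_prop))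
  have hHA : ∀ ω, GoodSite ω → (ω ∈ H ∩ {ω | Rings m s ω.2} ↔
      ω ∈ A ∩ {ω | s < arrival (m + 1) ω.2}) := by
    intro ω hω
    constructor
    · rintro ⟨h1, h2⟩
      exact ⟨⟨fun u hu => (siteState_eq_stateUpTo hω (hT u hu) h2).symm.trans (h1 u hu), h2.1⟩, h2.2⟩
    · rintro ⟨⟨h1, h2⟩, h3⟩
      exact ⟨fun u hu => (siteState_eq_stateUpTo hω (hT u hu) ⟨h2, h3⟩).trans (h1 u hu), h2, h3⟩
  set h : ℝ≥0∞ := siteLaw (H ∩ {ω | Rings m s ω.2}) with hh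
  have hfin : h ≠ ⊤ := measure_ne_top _ _
  set x : ℕ → ℝ≥0∞ := fun n => siteLaw (H ∩ {ω | Rings m s ω.2} ∩ {ω | Rings n t ω.2}) with hx
  have hxsum : ∑' n, x n = h := (siteLaw_eq_tsum_rings (hHm.inter hRs) (hs.trans hst)).symm
  have hxm : x m = h * ENNReal.ofReal e := by
    have h1 : x m = siteLaw (A ∩ {ω | t < arrival (m + 1) ω.2}) := by
      refine measure_congr ?_
      filter_upwards [ae_goodSite] with ω hω
      refine propext ⟨fun ⟨h1, h2⟩ => ⟨((hHA ω hω).1 h1).1, h2.2⟩, fun ⟨h1, h2⟩ => ?_⟩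
      have h2' : t < arrival (m + 1) ω.2 := h2
      exact ⟨(hHA ω hω).2 ⟨h1, hst.trans_lt h2'⟩, h1.2.trans hst, h2⟩
    have h2 : h = siteLaw (A ∩ {ω | s < arrival (m + 1) ω.2}) := by
      refine measure_congr ?_
      filter_upwards [ae_goodSite] with ω hω using propext (hHA ω hω)
    rw [h1, h2]
    refine siteLaw_inter_tail hAm m hst (fun b g y => ?_) fun ω hω => hω.2
    simp [hA, stateUpTo_update_waiting, arrival_update]
  have hy : ∀ n, siteLaw (H ∩ {ω | siteState t ω = c} ∩ {ω | Rings m s ω.2} ∩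
      {ω | Rings n t ω.2}) = if n = m then (if a s = c then x n else 0) else x n * 2⁻¹ := by
    intro n
    split_ifs with hnm hac
    · subst hnm
      refine measure_congr ?_
      filter_upwards [ae_goodSite] with ω hω
      refine propext ⟨fun ⟨⟨⟨h1, _⟩, h2⟩, h3⟩ => ⟨⟨h1, h2⟩, h3⟩, fun ⟨⟨h1, h2⟩, h3⟩ => ⟨⟨⟨h1, ?_⟩, h2⟩, h3⟩⟩
      exact (hω.siteState_eq h3).trans ((hω.siteState_eq h2).symm.trans ((h1 s hsT).trans hac))
    · subst hnm
      refine measure_mono_null_ae (t := ∅) ?_ measure_empty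
      filter_upwards [ae_goodSite] with ω hω
      rintro ⟨⟨⟨h1, h4⟩, h2⟩, h3⟩
      exact hac ((h1 s hsT).symm.trans ((hω.siteState_eq h2).trans
        ((hω.siteState_eq h3).symm.trans h4)))
    · rcases lt_or_gt_of_ne hnm with hlt | hgt
      · have hz : x n = 0 := by
          refine measure_mono_null_ae (t := ∅) ?_ measure_empty
          filter_upwards [ae_goodSite] with ω hω
          rintro ⟨⟨h1, h2⟩, h3⟩
          exact absurd (h2.mono hω.2.1 hst h3) (by omega)
        rw [hz, zero_mul]
        exact measure_mono_null
          (Set.inter_subset_inter_left _ (Set.inter_subset_inter_left _ Set.inter_subset_left)) hz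
      · set K : Set Site := A ∩ {ω | s < arrival (m + 1) ω.2} ∩ {ω | Rings n t ω.2} with hK
        have hKm : MeasurableSet K := (hAm.inter
          (measurableSet_lt (by fun_prop) (by fun_prop))).inter (measurableSet_rings n t)
        have h1 : x n = siteLaw K := by
          refine measure_congr ?_
          filter_upwards [ae_goodSite] with ω hω
          exact propext (and_congr_left' (hHA ω hω))
        rw [h1, ← siteLaw_inter_fresh_bit hKm n (fun b g y => by
          simp [hK, hA, stateUpTo_update_bit _ _ _ _ _ hgt]) c]
        refine measure_congr ?_
        filter_upwards [ae_goodSite] with ω hω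
        refine propext ⟨fun ⟨⟨⟨h1, h4⟩, h2⟩, h3⟩ => ⟨⟨(hHA ω hω).1 ⟨h1, h2⟩, h3⟩, ?_⟩,
          fun ⟨⟨h1, h3⟩, h4⟩ => ⟨⟨⟨((hHA ω hω).2 h1).1, ?_⟩, ((hHA ω hω).2 h1).2⟩, h3⟩⟩
        · exact (hω.siteState_eq h3).symm.trans h4
        · exact (hω.siteState_eq h3).trans h4
  rw [siteLaw_eq_tsum_rings ((hHm.inter hXm).inter hRs) (hs.trans hst)]
  simp_rw [hy]
  have hite : ∑' n, (if n = m then x m * 2⁻¹ else 0) = h * ENNReal.ofReal (e / 2) := by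
    rw [tsum_ite_eq, hxm, mul_assoc, ENNReal.ofReal_div_of_pos two_pos, div_eq_mul_inv]
    simp
  have hhalf : ∑' n, x n * 2⁻¹ = h * ENNReal.ofReal (1 / 2) := by
    rw [ENNReal.tsum_mul_right, hxsum, ENNReal.ofReal_div_of_pos two_pos]
    simp
  unfold trans
  rw [← he]
  split_ifs with hac
  · have : ∀ n, (if n = m then x n else x n * 2⁻¹) =
        x n * 2⁻¹ + (if n = m then x m * 2⁻¹ else 0) := by
      intro n
      split_ifs with hnm
      · subst hnm
        rw [← mul_add, ENNReal.inv_two_add_inv_two, mul_one]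
      · rw [add_zero]
    simp_rw [this]
    rw [ENNReal.tsum_add, hite, hhalf, ← mul_add, ← ENNReal.ofReal_add (by positivity) (by positivity)]
    congr 2
    ring
  -- Subtraction in `ℝ≥0∞` is avoided: the missing term `h * e / 2` is added to both sides and
  -- cancelled at the end, which its finiteness permits.
  · have : ∑' n, (if n = m then 0 else x n * 2⁻¹) + h * ENNReal.ofReal (e / 2) =
        h * ENNReal.ofReal ((1 - e) / 2) + h * ENNReal.ofReal (e / 2) := by
      rw [← mul_add, ← ENNReal.ofReal_add (by linarith) (by positivity), ← hite,
        ← ENNReal.tsum_add, show (1 - e) / 2 + e / 2 = 1 / 2 by ring, ← hhalf]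
      refine tsum_congr fun n => ?_
      split_ifs with hnm
      · subst hnm
        rw [zero_add]
      · rw [add_zero]
    exact (ENNReal.add_left_inj (ENNReal.mul_ne_top hfin ENNReal.ofReal_ne_top)).1 this

end DynBits

namespace DynBits

/-! ### Independence of the sites -/

/-- The bits and the waiting times of site `i`. -/
def siteOf (i : ℕ) (ω : Sample) : Site := (fun j => ω.1 (i, j), fun j => ω.2 (i, j))

@[fun_prop]
theorem measurable_siteOf (i : ℕ) : Measurable (siteOf i) := by
  unfold siteOf
  fun_prop

/-- Currying the index set turns both arrays into independent rows. For fixed bits the waiting times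
of different sites factor, and the resulting functions of the bit rows are again independent. -/
theorem law_forall_siteOf_mem (s : Finset ℕ) {A : ℕ → Set Site} (hA : ∀ i, MeasurableSet (A i)) :
    law half {ω | ∀ i ∈ s, siteOf i ω ∈ A i} = ∏ i ∈ s, siteLaw (A i) := by
  set β := Measure.infinitePi fun _ : ℕ => bernoulliMeasure (1 : ℕ) 0 half with hβ
  set η := Measure.infinitePi fun _ : ℕ => expMeasure 1 with hη
  have h1 : (Measure.infinitePi fun _ : ℕ × ℕ => bernoulliMeasure (1 : ℕ) 0 half).map
      (MeasurableEquiv.curry ℕ ℕ ℕ) = Measure.infinitePi fun _ : ℕ => β :=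
    Measure.infinitePi_map_curry (fun _ _ : ℕ => bernoulliMeasure (1 : ℕ) 0 half)
  have h2 : (Measure.infinitePi fun _ : ℕ × ℕ => expMeasure 1).map
      (MeasurableEquiv.curry ℕ ℕ ℝ) = Measure.infinitePi fun _ : ℕ => η :=
    Measure.infinitePi_map_curry (fun _ _ : ℕ => expMeasure 1)
  have hmap : (law half).map (Prod.map (MeasurableEquiv.curry ℕ ℕ ℕ) (MeasurableEquiv.curry ℕ ℕ ℝ))
      = (Measure.infinitePi fun _ : ℕ => β).prod (Measure.infinitePi fun _ : ℕ => η) := by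
    rw [law, ← Measure.map_prod_map _ _ (MeasurableEquiv.measurable _)
      (MeasurableEquiv.measurable _), h1, h2]
  have hmeas : MeasurableSet {p : (ℕ → ℕ → ℕ) × (ℕ → ℕ → ℝ) | ∀ i ∈ s, (p.1 i, p.2 i) ∈ A i} := by
    have : {p : (ℕ → ℕ → ℕ) × (ℕ → ℕ → ℝ) | ∀ i ∈ s, (p.1 i, p.2 i) ∈ A i} =
        ⋂ i ∈ s, (fun p : (ℕ → ℕ → ℕ) × (ℕ → ℕ → ℝ) => (p.1 i, p.2 i)) ⁻¹' A i := by
      ext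
      simp
    rw [this]
    exact Finset.measurableSet_biInter s fun i _ =>
      (show Measurable fun p : (ℕ → ℕ → ℕ) × (ℕ → ℕ → ℝ) => (p.1 i, p.2 i) by fun_prop) (hA i)
  have h3 : law half {ω | ∀ i ∈ s, siteOf i ω ∈ A i} =
      ((Measure.infinitePi fun _ : ℕ => β).prod (Measure.infinitePi fun _ : ℕ => η))
        {p | ∀ i ∈ s, (p.1 i, p.2 i) ∈ A i} := by
    rw [← hmap, Measure.map_apply (by fun_prop) hmeas]
    rfl
  rw [h3, Measure.prod_apply hmeas]
  set f : ℕ → (ℕ → ℕ) → ℝ≥0∞ := fun i b => η (Prod.mk b ⁻¹' A i) with hf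
  have hfm : ∀ i, Measurable (f i) := fun i => measurable_measure_prodMk_left (hA i)
  have h4 : ∀ b : ℕ → ℕ → ℕ, (Measure.infinitePi fun _ : ℕ => η)
      (Prod.mk b ⁻¹' {p : (ℕ → ℕ → ℕ) × (ℕ → ℕ → ℝ) | ∀ i ∈ s, (p.1 i, p.2 i) ∈ A i}) =
      ∏ i ∈ s, f i (b i) := by
    intro b
    exact Measure.infinitePi_pi (fun _ : ℕ => η) (t := fun i => Prod.mk (b i) ⁻¹' A i)
      fun i _ => measurable_prodMk_left (hA i)
  simp_rw [h4]
  rw [lintegral_prod_eq_prod_lintegral_of_indepFun s (fun i (b : ℕ → ℕ → ℕ) => f i (b i))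
    (iIndepFun_infinitePi (P := fun _ : ℕ => β) (X := f) hfm)
    fun i => (hfm i).comp (measurable_pi_apply i)]
  refine Finset.prod_congr rfl fun i _ => ?_
  rw [(measurePreserving_eval_infinitePi (fun _ : ℕ => β) i).lintegral_comp (hfm i), siteLaw,
    Measure.prod_apply (hA i)]

theorem measurePreserving_siteOf (i : ℕ) : MeasurePreserving (siteOf i) (law half) siteLaw := by
  refine ⟨measurable_siteOf i, Measure.ext fun A hA => ?_⟩
  rw [Measure.map_apply (measurable_siteOf i) hA]
  simpa [Set.preimage] using law_forall_siteOf_mem {i} (A := fun _ => A) fun _ => hA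

theorem ae_forall_goodSite : ∀ᵐ ω ∂law half, ∀ i, GoodSite (siteOf i ω) :=
  ae_all_iff.2 fun i => (measurePreserving_siteOf i).quasiMeasurePreserving.ae ae_goodSite

/-! ### Configurations -/

/-- The states of the first `k` sites at time `t`. -/
noncomputable def config (k : ℕ) (t : ℝ) (ω : Sample) : Fin k → Bool :=
  fun i => siteState t (siteOf i ω)

@[fun_prop]
theorem measurable_config (k : ℕ) (t : ℝ) : Measurable (config k t) :=
  measurable_pi_iff.2 fun i => (measurable_siteState t).comp (measurable_siteOf i)

/-- The number of ones in a configuration. -/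
def ones {k : ℕ} (c : Fin k → Bool) : ℕ := (Finset.univ.filter fun i => c i = true).card

theorem measurableSet_ones_config (k n : ℕ) (t : ℝ) :
    MeasurableSet {ω | ones (config k t ω) = n} :=
  measurable_config k t (MeasurableSet.of_discrete (s := {c | ones c = n}))

theorem bit_eq {ω : Sample} {i : ℕ} (h : GoodSite (siteOf i ω)) {t : ℝ} (ht : 0 ≤ t) :
    bit i t ω = if siteState t (siteOf i ω) = true then 1 else 0 := by
  obtain ⟨m, hm⟩ := h.exists_rings ht
  have hb : bit i t ω = ω.1 (i, m) := by
    rw [bit, tsum_eq_single m]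
    · exact if_pos hm
    · exact fun n hn => if_neg fun h' => hn (Rings.unique h.2.1 h' hm)
  rw [h.siteState_eq hm, hb]
  have h01 : ω.1 (i, m) = 0 ∨ ω.1 (i, m) = 1 := h.1 m
  rcases h01 with h0 | h0 <;> simp [siteOf, h0]

theorem S_eq_ones {ω : Sample} (h : ∀ i, GoodSite (siteOf i ω)) {t : ℝ} (ht : 0 ≤ t) (k : ℕ) :
    S k t ω = ones (config k t ω) := by
  rw [S, ones, Finset.card_filter, Finset.sum_range]
  exact Finset.sum_congr rfl fun i _ => bit_eq (h i) ht

theorem law_config_markov (k : ℕ) (T : Finset ℝ) (a : ℝ → Fin k → Bool) {s t : ℝ} (hs : 0 ≤ s)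
    (hst : s ≤ t) (hsT : s ∈ T) (hT : ∀ u ∈ T, u ≤ s) (c : Fin k → Bool) :
    law half ({ω | ∀ u ∈ T, config k u ω = a u} ∩ {ω | config k t ω = c}) =
      law half {ω | ∀ u ∈ T, config k u ω = a u} *
        ENNReal.ofReal (∏ i, trans (t - s) (a s i) (c i)) := by
  have htr : ∀ x y, 0 ≤ trans (t - s) x y := fun x y => by
    have : Real.exp (-(t - s)) ≤ 1 := Real.exp_le_one_iff.2 (by linarith)
    have := Real.exp_pos (-(t - s))
    unfold trans
    split_ifs <;> linarith
  set a' : ℕ → ℝ → Bool := fun i u => if h : i < k then a u ⟨i, h⟩ else true with ha'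
  set c' : ℕ → Bool := fun i => if h : i < k then c ⟨i, h⟩ else true with hc'
  set H : ℕ → Set Site := fun i => {ω | ∀ u ∈ T, siteState u ω = a' i u} with hH
  have hHm : ∀ i, MeasurableSet (H i) := fun i => by
    have : H i = ⋂ u ∈ T, siteState u ⁻¹' {a' i u} := by
      ext
      simp [hH]
    rw [this]
    exact Finset.measurableSet_biInter T fun u _ => measurable_siteState u (measurableSet_singleton _)
  have hXm : ∀ i, MeasurableSet {ω | siteState t ω = c' i} := fun i =>
    measurable_siteState t (measurableSet_singleton _)
  have h1 : {ω | ∀ u ∈ T, config k u ω = a u} =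
      {ω | ∀ i ∈ Finset.range k, siteOf i ω ∈ H i} := by
    ext ω
    simp only [Set.mem_ofPred_eq, funext_iff, config, hH, ha', Finset.mem_range]
    constructor
    · intro h i hi u hu
      rw [dif_pos hi]
      exact h u hu ⟨i, hi⟩
    · intro h u hu i
      have := h i i.2 u hu
      rwa [dif_pos i.2] at this
  have h2 : {ω | config k t ω = c} =
      {ω | ∀ i ∈ Finset.range k, siteOf i ω ∈ {ω | siteState t ω = c' i}} := by
    ext ω
    simp only [Set.mem_ofPred_eq, funext_iff, config, hc', Finset.mem_range]
    constructor
    · intro h i hi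
      rw [dif_pos hi]
      exact h ⟨i, hi⟩
    · intro h i
      have := h i i.2
      rwa [dif_pos i.2] at this
  have h3 : {ω | ∀ i ∈ Finset.range k, siteOf i ω ∈ H i} ∩
      {ω | ∀ i ∈ Finset.range k, siteOf i ω ∈ {ω | siteState t ω = c' i}} =
      {ω | ∀ i ∈ Finset.range k, siteOf i ω ∈ H i ∩ {ω | siteState t ω = c' i}} := by
    ext ω
    exact forall₂_and.symm
  rw [h1, h2, h3, law_forall_siteOf_mem _ fun i => (hHm i).inter (hXm i),
    law_forall_siteOf_mem _ hHm, ENNReal.ofReal_prod_of_nonneg fun i _ => htr _ _]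
  have h4 : ∏ i : Fin k, ENNReal.ofReal (trans (t - s) (a s i) (c i)) =
      ∏ i ∈ Finset.range k, ENNReal.ofReal (trans (t - s) (a' i s) (c' i)) := by
    rw [Finset.prod_range]
    refine Finset.prod_congr rfl fun i _ => ?_
    simp [ha', hc']
  rw [h4, ← Finset.prod_mul_distrib]
  exact Finset.prod_congr rfl fun i _ => siteLaw_markov T (a' i) hs hst hsT hT (c' i)

theorem card_filter_not_eq {k n : ℕ} (hk : k = 2 * n) {c : Fin k → Bool} (hc : ones c = n) :
    (Finset.univ.filter fun i => ¬ c i = true).card = n := by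
  have := Finset.card_filter_add_card_filter_not (s := Finset.univ) fun i => c i = true
  rw [Finset.card_univ, Fintype.card_fin] at this
  unfold ones at hc
  omega

/-- A site flips during `Δ` with probability `q = (1 - exp (-Δ)) / 2`, and `2q(1 - q) = (1 - exp
(-2Δ)) / 2`. -/
theorem sum_prod_trans {k n : ℕ} (hk : k = 2 * n) {Δ : ℝ} {c : Fin k → Bool}
    (hc : ones c = n) :
    ∑ c' : Fin k → Bool with ones c' = n, ∏ i, trans Δ (c i) (c' i) =
      retProb n ((1 - Real.exp (-(2 * Δ))) / 2) := by
  have h := sum_prod_flip_eq_retProb n ((1 - Real.exp (-Δ)) / 2) c hc (card_filter_not_eq hk hc)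
  have he : Real.exp (-(2 * Δ)) = Real.exp (-Δ) ^ 2 := by
    rw [← Real.exp_nat_mul]
    push_cast
    ring_nf
  rw [he, show (1 - Real.exp (-Δ) ^ 2) / 2 = 2 * ((1 - Real.exp (-Δ)) / 2) *
    (1 - (1 - Real.exp (-Δ)) / 2) by ring, ← h]
  rfl

/-- Conditionally on a history up to time `s` with `n` ones at time `s`, the probability of `n`
ones at time `t` does not depend on the history. -/
theorem law_history_inter {k n : ℕ} (hk : k = 2 * n) (T : Finset ℝ) {s t : ℝ} (hs : 0 ≤ s)
    (hst : s ≤ t) (hsT : s ∈ T) (hT : ∀ u ∈ T, u ≤ s) (B : Finset (T → Fin k → Bool))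
    (hB : ∀ a ∈ B, ones (a ⟨s, hsT⟩) = n) :
    law half ({ω | (fun u : T => config k u ω) ∈ B} ∩ {ω | ones (config k t ω) = n}) =
      law half {ω | (fun u : T => config k u ω) ∈ B} *
        ENNReal.ofReal (retProb n ((1 - Real.exp (-(2 * (t - s)))) / 2)) := by
  classical
  have htr : ∀ x y, 0 ≤ trans (t - s) x y := fun x y => by
    have : Real.exp (-(t - s)) ≤ 1 := Real.exp_le_one_iff.2 (by linarith)
    have := Real.exp_pos (-(t - s))
    unfold trans
    split_ifs <;> linarith
  set hist : Sample → T → Fin k → Bool := fun ω u => config k u ω with hhist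
  have hhm : Measurable hist := measurable_pi_iff.2 fun u => measurable_config k u
  have hjm : Measurable fun ω => (hist ω, config k t ω) := hhm.prodMk (measurable_config k t)
  set C : Finset (Fin k → Bool) := Finset.univ.filter fun c => ones c = n with hC
  have h1 : {ω | (fun u : T => config k u ω) ∈ B} = hist ⁻¹' (B : Set (T → Fin k → Bool)) := rfl
  have h2 : {ω | (fun u : T => config k u ω) ∈ B} ∩ {ω | ones (config k t ω) = n} =
      (fun ω => (hist ω, config k t ω)) ⁻¹' ((B ×ˢ C : Finset _) : Set _) := by
    ext ω
    simp [hhist, hC]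
  rw [h2, h1, ← sum_measure_preimage_singleton B fun a _ => hhm (measurableSet_singleton a),
    ← sum_measure_preimage_singleton (B ×ˢ C) fun a _ => hjm (measurableSet_singleton a),
    Finset.sum_product, Finset.sum_mul]
  refine Finset.sum_congr rfl fun a ha => ?_
  set a' : ℝ → Fin k → Bool := fun u => if h : u ∈ T then a ⟨u, h⟩ else fun _ => true with ha'
  have has : a' s = a ⟨s, hsT⟩ := by simp [ha', hsT]
  have h3 : hist ⁻¹' {a} = {ω | ∀ u ∈ T, config k u ω = a' u} := by
    ext ω
    simp only [hhist, ha', Set.mem_preimage, Set.mem_singleton_iff, Set.mem_ofPred_eq, funext_iff,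
      Subtype.forall]
    refine forall₂_congr fun u hu => ?_
    rw [dif_pos hu]
  have h4 : ∀ c, (fun ω => (hist ω, config k t ω)) ⁻¹' {(a, c)} =
      {ω | ∀ u ∈ T, config k u ω = a' u} ∩ {ω | config k t ω = c} := by
    intro c
    rw [← h3]
    ext ω
    simp
  simp_rw [h4, law_config_markov k T a' hs hst hsT hT]
  rw [← Finset.mul_sum, h3, ← ENNReal.ofReal_sum_of_nonneg fun c _ =>
    Finset.prod_nonneg fun i _ => htr _ _, hC, has, sum_prod_trans hk (hB a ha)]

theorem law_ones_config {k n : ℕ} (hk : k = 2 * n) {t : ℝ} (ht : 0 ≤ t) :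
    law half {ω | ones (config k t ω) = n} = ENNReal.ofReal (retProb n (1 / 2)) := by
  classical
  set C : Finset (Fin k → Bool) := Finset.univ.filter fun c => ones c = n with hC
  have h1 : {ω | ones (config k t ω) = n} = config k t ⁻¹' (C : Set (Fin k → Bool)) := by
    ext
    simp [hC]
  have h2 : ∀ c : Fin k → Bool, law half (config k t ⁻¹' {c}) =
      ENNReal.ofReal (∏ _i : Fin k, (1 / 2 : ℝ)) := by
    intro c
    have h3 : config k t ⁻¹' {c} = {ω | ∀ i ∈ Finset.range k, siteOf i ω ∈
        {ω | siteState t ω = if h : i < k then c ⟨i, h⟩ else true}} := by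
      ext ω
      simp only [Set.mem_preimage, Set.mem_singleton_iff, Set.mem_ofPred_eq, funext_iff, config,
        Finset.mem_range]
      constructor
      · intro h i hi
        rw [dif_pos hi]
        exact h ⟨i, hi⟩
      · intro h i
        have := h i i.2
        rwa [dif_pos i.2] at this
    rw [h3, law_forall_siteOf_mem _
      (A := fun i => {ω | siteState t ω = if h : i < k then c ⟨i, h⟩ else true})
      fun i => measurable_siteState t (measurableSet_singleton _)]
    simp_rw [siteLaw_siteState ht]
    simp [ENNReal.ofReal_pow, ENNReal.inv_pow]
  -- For `q = 1/2` all flip weights equal `1/2`, whatever the starting configuration, so any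
  -- balanced `c₀` turns the uniform count into a return probability.
  obtain ⟨c₀, hc₀⟩ : ∃ c : Fin k → Bool, ones c = n := by
    refine ⟨fun i => decide ((i : ℕ) < n), ?_⟩
    subst hk
    rw [ones, Finset.card_filter, ← Finset.sum_range fun i => if decide (i < n) = true then 1 else 0,
      two_mul, Finset.sum_range_add]
    simp only [decide_eq_true_eq, Finset.sum_boole, Nat.cast_id, add_lt_iff_neg_left, not_lt_zero]
    rw [Finset.filter_true_of_mem fun x hx => Finset.mem_range.1 hx]
    simp
  have h5 := sum_prod_flip_eq_retProb n (1 / 2) c₀ hc₀ (card_filter_not_eq hk hc₀)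
  rw [h1, ← sum_measure_preimage_singleton C fun a _ =>
    measurable_config k t (measurableSet_singleton a)]
  simp_rw [h2]
  rw [← ENNReal.ofReal_sum_of_nonneg fun c _ => by positivity, hC]
  congr 1
  norm_num at h5 ⊢
  exact h5

end DynBits

/-! ### The kernel `ψ` and packings indexed by finite sets. -/

namespace BoxProfile

theorem ψ_nonneg (s x : ℝ) : 0 ≤ ψ s x := by
  unfold ψ
  split_ifs
  · exact zero_le_one
  · exact le_min zero_le_one (Real.rpow_nonneg (abs_nonneg x) _)

theorem ψ_le_one (s x : ℝ) : ψ s x ≤ 1 := by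
  unfold ψ
  split_ifs
  · exact le_rfl
  · exact min_le_left _ _

theorem ψ_zero (s : ℝ) : ψ s 0 = 1 := if_pos rfl

theorem ψ_abs (s x : ℝ) : ψ s |x| = ψ s x := by simp [ψ]

theorem ψ_neg (s x : ℝ) : ψ s (-x) = ψ s x := by simp [ψ]

theorem ofReal_sum_le_N {F : Set ℝ} {s r : ℝ} (A : Finset ℝ) (hA : ∀ x ∈ A, x ∈ F) (w : ℝ → ℝ)
    (hw : ∀ x ∈ A, 0 ≤ w x) (h : ∀ x ∈ A, ∑ y ∈ A, w y * ψ s ((x - y) / r) ≤ 1) :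
    ENNReal.ofReal (∑ x ∈ A, w x) ≤ N F s r := by
  have hsum : ∀ f : ℝ → ℝ, ∑ i, f (A.equivFin.symm i) = ∑ x ∈ A, f x := fun f => by
    rw [Equiv.sum_comp A.equivFin.symm fun x : A => f x, Finset.sum_coe_sort]
  have hp : IsPacking F s r A.card (fun i => w (A.equivFin.symm i))
      fun i => (A.equivFin.symm i : ℝ) := by
    refine ⟨fun i => hA _ (A.equivFin.symm i).2, fun i => hw _ (A.equivFin.symm i).2, fun i => ?_⟩
    rw [hsum fun y => w y * ψ s ((A.equivFin.symm i - y) / r)]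
    exact h _ (A.equivFin.symm i).2
  rw [← hsum]
  exact le_iSup_of_le _ (le_iSup_of_le _ (le_iSup_of_le _ (le_iSup_of_le hp le_rfl)))

end BoxProfile

namespace DynBits

open BoxProfile

/-! ### The conditional hitting probabilities and the kernel `ψ` -/

theorem retProb_half_le {n : ℕ} (hn : 0 < n) :
    retProb n (1 / 2) ≤ 2 * ((2 * n : ℕ) : ℝ) ^ (-(1 / 2) : ℝ) := by
  have h := retProb_le_rpow hn (ρ := 1 / 2) (by norm_num) le_rfl
  have hn' : (0 : ℝ) < n := by exact_mod_cast hn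
  have h4 : ((4 : ℝ)⁻¹) ^ (-(1 / 2) : ℝ) = 2 := by
    rw [Real.inv_rpow (by norm_num), Real.rpow_neg (by norm_num), inv_inv, ← Real.sqrt_eq_rpow,
      show (4 : ℝ) = 2 ^ 2 by norm_num, Real.sqrt_sq (by norm_num)]
  have h5 : (n : ℝ) * (1 / 2) = 4⁻¹ * (2 * n : ℕ) := by
    push_cast
    ring
  rwa [h5, Real.mul_rpow (by norm_num) (by positivity), h4] at h

theorem le_retProb_half {n : ℕ} (hn : 0 < n) :
    ((2 * n : ℕ) : ℝ) ^ (-(1 / 2) : ℝ) / (2 * Real.pi) ≤ retProb n (1 / 2) := by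
  have hn' : (1 : ℝ) ≤ n := by exact_mod_cast hn
  have hk : (0 : ℝ) < (2 * n : ℕ) := by exact_mod_cast (by omega : 0 < 2 * n)
  refine le_retProb (by norm_num) le_rfl (by positivity)
    (Real.rpow_le_one_of_one_le_of_nonpos (by push_cast; linarith) (by norm_num)) ?_
  rw [← Real.rpow_natCast, ← Real.rpow_mul hk.le]
  norm_num
  rw [Real.rpow_neg_one]
  field_simp
  norm_num

/-- Apply `le_retProb` with window `δ = ψ (1/2) (kΔ)`: here `ρ ≤ Δ` and `ψ² ≤ 1 / (2nΔ)`, so `n ρ δ²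
≤ 1`. No bound on `Δ` is needed in this direction. -/
theorem div_two_pi_le_retProb (n : ℕ) {Δ : ℝ} (hΔ : 0 ≤ Δ) :
    ψ (1 / 2) (Δ / (1 / (2 * n : ℕ))) / (2 * Real.pi) ≤
      retProb n ((1 - Real.exp (-(2 * Δ))) / 2) := by
  have h1 : Real.exp (-(2 * Δ)) ≤ 1 := Real.exp_le_one_iff.2 (by linarith)
  have h2 := Real.exp_pos (-(2 * Δ))
  have h3 := Real.add_one_le_exp (-(2 * Δ))
  refine le_retProb (by linarith) (by linarith) (ψ_nonneg _ _) (ψ_le_one _ _) ?_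
  have hn : (0 : ℝ) ≤ n := Nat.cast_nonneg n
  -- The quotient vanishes for `Δ = 0` and also for `n = 0`, where `1 / 0 = 0`; in both cases `n * Δ
  -- = 0`.
  rcases eq_or_ne (Δ / (1 / (2 * n : ℕ))) 0 with h0 | h0
  · have h00 : n * Δ = 0 := by
      rw [div_div_eq_mul_div, div_one] at h0
      push_cast at h0
      linarith
    rw [h0, ψ_zero]
    nlinarith
  · set y := Δ / (1 / (2 * n : ℕ)) with hy
    have hy' : y = 2 * (n * Δ) := by
      rw [hy, div_div_eq_mul_div, div_one]
      push_cast
      ring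
    have hy0 : 0 < y := lt_of_le_of_ne (by rw [hy']; positivity) h0.symm
    have hψ : ψ (1 / 2) y ^ 2 ≤ y⁻¹ := by
      have : ψ (1 / 2) y ≤ y ^ (-(1 / 2) : ℝ) := by
        rw [ψ, if_neg h0, abs_of_pos hy0]
        exact min_le_right _ _
      calc ψ (1 / 2) y ^ 2 ≤ (y ^ (-(1 / 2) : ℝ)) ^ 2 := by
            gcongr
            exact ψ_nonneg _ _
        _ = y⁻¹ := by
            rw [← Real.rpow_natCast, ← Real.rpow_mul hy0.le]
            norm_num
            rw [Real.rpow_neg_one]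
    calc n * ((1 - Real.exp (-(2 * Δ))) / 2) * ψ (1 / 2) y ^ 2
        ≤ n * Δ * y⁻¹ := by
          gcongr
          linarith
      _ ≤ 1 := by
          rw [← div_eq_mul_inv, div_le_one hy0, hy']
          nlinarith

/-- For `Δ ≤ D` convexity of `exp` gives `ρ ≥ Δ exp (-2D)`, which is where the factor `exp D` comes
from. Some bound on `Δ` is unavoidable, because `ρ` saturates at `1/2` whereas `ψ` keeps decaying.
-/
theorem retProb_le_ψ {n : ℕ} (hn : 0 < n) {Δ D : ℝ} (hΔ : 0 ≤ Δ) (hD : Δ ≤ D) :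
    retProb n ((1 - Real.exp (-(2 * Δ))) / 2) ≤
      2 * Real.exp D * ψ (1 / 2) (Δ / (1 / (2 * n : ℕ))) := by
  have h1 : Real.exp (-(2 * Δ)) ≤ 1 := Real.exp_le_one_iff.2 (by linarith)
  have h2 := Real.exp_pos (-(2 * Δ))
  have hn' : (0 : ℝ) < n := by exact_mod_cast hn
  have hD1 : 1 ≤ Real.exp D := Real.one_le_exp (hΔ.trans hD)
  have hle1 : retProb n ((1 - Real.exp (-(2 * Δ))) / 2) ≤ 1 :=
    retProb_le_one (by linarith) (by linarith)
  rcases hΔ.eq_or_lt with h0 | h0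
  · rw [← h0, zero_div, ψ_zero]
    rw [← h0] at hle1
    linarith
  · have hy : Δ / (1 / (2 * n : ℕ)) = 2 * n * Δ := by
      rw [div_div_eq_mul_div, div_one]
      push_cast
      ring
    have hy0 : 0 < 2 * n * Δ := by positivity
    rw [hy, ψ, if_neg hy0.ne', abs_of_pos hy0, mul_min_of_nonneg _ _ (by positivity)]
    refine le_min (by linarith) ?_
    have hρ : Δ * Real.exp (-(2 * D)) ≤ (1 - Real.exp (-(2 * Δ))) / 2 := by
      have h3 := Real.add_one_le_exp (2 * Δ)
      have h4 : Real.exp (2 * Δ) * Real.exp (-(2 * Δ)) = 1 := by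
        rw [← Real.exp_add]
        simp
      have h5 : Real.exp (-(2 * D)) ≤ Real.exp (-(2 * Δ)) := Real.exp_le_exp.2 (by linarith)
      nlinarith
    have hρ0 : 0 < Δ * Real.exp (-(2 * D)) := by positivity
    refine (retProb_le_rpow hn (hρ0.trans_le hρ) (by linarith)).trans ?_
    have h6 : (4⁻¹ * Real.exp (-(2 * D))) ^ (-(1 / 2) : ℝ) = 2 * Real.exp D := by
      rw [Real.mul_rpow (by norm_num) (Real.exp_pos _).le, ← Real.exp_mul, Real.inv_rpow
        (by norm_num), Real.rpow_neg (by norm_num), inv_inv, ← Real.sqrt_eq_rpow,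
        show (4 : ℝ) = 2 ^ 2 by norm_num, Real.sqrt_sq (by norm_num)]
      ring_nf
    rw [← h6, ← Real.mul_rpow (by positivity) hy0.le]
    refine Real.rpow_le_rpow_of_nonpos (by positivity) ?_ (by norm_num)
    nlinarith

/-! ### Joint hitting probabilities -/

/-- The Markov property at the first hit: "no hit on `T`, hit at `s`" is a history event ending in a
balanced configuration. With `T = ∅` it gives the joint law of two hits. -/
theorem law_first_hit_inter {k n : ℕ} (hk : k = 2 * n) (T : Finset ℝ) {s t : ℝ} (hs : 0 ≤ s)
    (hst : s ≤ t) (hT : ∀ u ∈ T, u < s) :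
    law half ({ω | (∀ u ∈ T, ones (config k u ω) ≠ n) ∧ ones (config k s ω) = n} ∩
        {ω | ones (config k t ω) = n}) =
      law half {ω | (∀ u ∈ T, ones (config k u ω) ≠ n) ∧ ones (config k s ω) = n} *
        ENNReal.ofReal (retProb n ((1 - Real.exp (-(2 * (t - s)))) / 2)) := by
  classical
  have hsT : s ∈ insert s T := Finset.mem_insert_self s T
  set B : Finset (↥(insert s T : Finset ℝ) → Fin k → Bool) := Finset.univ.filter fun a =>
    (∀ u (hu : u ∈ T), ones (a ⟨u, Finset.mem_insert_of_mem hu⟩) ≠ n) ∧ ones (a ⟨s, hsT⟩) = n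
    with hB
  have h := law_history_inter hk (insert s T) hs hst hsT (fun u hu => by
    rcases Finset.mem_insert.1 hu with h | h
    · exact h.le
    · exact (hT u h).le) B (fun a ha => (Finset.mem_filter.1 ha).2.2)
  have hset : {ω | (fun u : ↥(insert s T : Finset ℝ) => config k u ω) ∈ B} =
      {ω | (∀ u ∈ T, ones (config k u ω) ≠ n) ∧ ones (config k s ω) = n} := by
    ext ω
    simp [hB]
  rwa [hset] at h

theorem law_hit_inter_hit {k n : ℕ} (hk : k = 2 * n) {s t : ℝ} (hs : 0 ≤ s) (ht : 0 ≤ t) :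
    (law half).real ({ω | ones (config k s ω) = n} ∩ {ω | ones (config k t ω) = n}) =
      retProb n (1 / 2) * retProb n ((1 - Real.exp (-(2 * |s - t|))) / 2) := by
  wlog hst : s ≤ t generalizing s t
  · rw [Set.inter_comm, abs_sub_comm]
    exact this ht hs (le_of_not_ge hst)
  have h := law_first_hit_inter hk ∅ hs hst (by simp)
  have hnn : ∀ ρ, 0 ≤ ρ → ρ ≤ 1 / 2 → 0 ≤ retProb n ρ := fun ρ h0 h1 => by
    have := le_retProb (n := n) h0 h1 le_rfl zero_le_one (by simp)
    simpa using this
  have h1 : Real.exp (-(2 * (t - s))) ≤ 1 := Real.exp_le_one_iff.2 (by linarith)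
  have h2 := Real.exp_pos (-(2 * (t - s)))
  simp only [Finset.notMem_empty, false_imp_iff, implies_true, true_and] at h
  rw [abs_sub_comm, abs_of_nonneg (by linarith), measureReal_def, h, law_ones_config hk hs,
    ENNReal.toReal_mul, ENNReal.toReal_ofReal (hnn _ (by norm_num) le_rfl),
    ENNReal.toReal_ofReal (hnn _ (by linarith) (by linarith))]

/-! ### The lower bound on the hitting probability -/

/-- Second moment method for `Z = ∑ w i 1_{E i}`. Its mean is `p ∑ w i`; two-point probabilities are
at most `p C ψ`, so the packing condition bounds the second moment by `C p ∑ w i`. -/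
theorem sum_weights_le_law {k n : ℕ} (hn : 0 < n) (hk : k = 2 * n) {F : Set ℝ} {D : ℝ}
    (hF : F ⊆ Set.Icc 0 D) {m : ℕ} {w x : Fin m → ℝ} (hp : IsPacking F (1 / 2) (1 / k) m w x) :
    retProb n (1 / 2) * (∑ i, w i) / (2 * Real.exp D) ≤
      (law half).real (⋃ i, {ω | ones (config k (x i) ω) = n}) := by
  obtain ⟨hxF, hw, hp⟩ := hp
  set p := retProb n (1 / 2) with hpdef
  set C := 2 * Real.exp D with hC
  have hC0 : 0 < C := by positivity
  have hp0 : 0 ≤ p := by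
    have := le_retProb (n := n) (ρ := 1 / 2) (by norm_num) le_rfl le_rfl zero_le_one (by simp)
    rwa [zero_div] at this
  set E : Fin m → Set Sample := fun i => {ω | ones (config k (x i) ω) = n} with hE
  have hEm : ∀ i, MeasurableSet (E i) := fun i => measurableSet_ones_config k n (x i)
  have hone : ∀ i, (law half).real (E i) = p := fun i => by
    rw [measureReal_def, law_ones_config hk (hF (hxF i)).1, ENNReal.toReal_ofReal hp0]
  have htwo : ∀ i j, (law half).real (E i ∩ E j) ≤
      p * (C * ψ (1 / 2) ((x i - x j) / (1 / k))) := fun i j => by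
    rw [law_hit_inter_hit hk (hF (hxF i)).1 (hF (hxF j)).1]
    refine mul_le_mul_of_nonneg_left ?_ hp0
    have hD : |x i - x j| ≤ D := by
      have h1 := hF (hxF i)
      have h2 := hF (hxF j)
      rw [abs_le]
      constructor <;> linarith [h1.1, h1.2, h2.1, h2.2]
    have h := retProb_le_ψ hn (abs_nonneg (x i - x j)) hD
    rw [← hk] at h
    rwa [← ψ_abs _ ((x i - x j) / (1 / k)), abs_div, abs_of_nonneg (by positivity : (0 : ℝ) ≤ 1 / k)]
  set Z : Sample → ℝ := fun ω => ∑ i, w i * (E i).indicator 1 ω with hZ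
  have hZ2 : ∀ ω, Z ω ^ 2 = ∑ i, ∑ j, w i * w j * (E i ∩ E j).indicator 1 ω := fun ω => by
    rw [sq, hZ, Finset.sum_mul_sum]
    refine Finset.sum_congr rfl fun i _ => Finset.sum_congr rfl fun j _ => ?_
    rw [Set.inter_indicator_one]
    simp only [Pi.mul_apply]
    ring
  have hint : ∀ (A : Set Sample), MeasurableSet A → ∀ c : ℝ,
      Integrable (fun ω => c * A.indicator 1 ω) (law half) := fun A hA c =>
    ((integrable_indicator_iff hA).2 (integrable_const (1 : ℝ)).integrableOn).const_mul c
  have hinteg : ∀ (A : Set Sample), MeasurableSet A → ∀ c : ℝ,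
      ∫ ω, c * A.indicator 1 ω ∂law half = c * (law half).real A := fun A hA c => by
    rw [integral_const_mul, integral_indicator_one hA]
  have hZi : Integrable Z (law half) := integrable_finsetSum _ fun i _ => hint _ (hEm i) _
  have hZ2i : Integrable (fun ω => Z ω ^ 2) (law half) := by
    simp_rw [hZ2]
    exact integrable_finsetSum _ fun i _ => integrable_finsetSum _ fun j _ =>
      hint _ ((hEm i).inter (hEm j)) _
  have hEZ : ∫ ω, Z ω ∂law half = p * ∑ i, w i := by
    rw [hZ, integral_finsetSum _ fun i _ => hint _ (hEm i) _, Finset.mul_sum]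
    refine Finset.sum_congr rfl fun i _ => ?_
    rw [hinteg _ (hEm i), hone, mul_comm]
  have hEZ2 : ∫ ω, Z ω ^ 2 ∂law half ≤ C * (p * ∑ i, w i) := by
    simp_rw [hZ2]
    rw [integral_finsetSum _ fun i _ => integrable_finsetSum _ fun j _ =>
      hint _ ((hEm i).inter (hEm j)) _]
    simp_rw [integral_finsetSum _ fun j _ => hint _ ((hEm _).inter (hEm j)) _,
      hinteg _ ((hEm _).inter (hEm _))]
    calc ∑ i, ∑ j, w i * w j * (law half).real (E i ∩ E j)
        ≤ ∑ i, ∑ j, w i * w j * (p * (C * ψ (1 / 2) ((x i - x j) / (1 / k)))) :=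
          Finset.sum_le_sum fun i _ => Finset.sum_le_sum fun j _ =>
            mul_le_mul_of_nonneg_left (htwo i j) (mul_nonneg (hw i) (hw j))
      _ = ∑ i, (C * p * w i) * ∑ j, w j * ψ (1 / 2) ((x i - x j) / (1 / k)) := by
          refine Finset.sum_congr rfl fun i _ => ?_
          rw [Finset.mul_sum]
          refine Finset.sum_congr rfl fun j _ => ?_
          ring
      _ ≤ ∑ i, (C * p * w i) * 1 := by
          refine Finset.sum_le_sum fun i _ => mul_le_mul_of_nonneg_left (hp i) ?_
          have := hw i
          positivity
      _ = _ := by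
          rw [Finset.mul_sum, Finset.mul_sum]
          refine Finset.sum_congr rfl fun i _ => ?_
          ring
  have hUm : MeasurableSet (⋃ i, E i) := MeasurableSet.iUnion hEm
  -- In place of Cauchy–Schwarz: `1 - (1 - a Z)² ≤ 1` where a hit occurs, and the left side is `0`
  -- elsewhere. The value `a = C⁻¹` is the ratio of the mean to the bound for the second moment.
  have hpt : ∀ ω, 2 * C⁻¹ * Z ω - C⁻¹ ^ 2 * Z ω ^ 2 ≤ 1 * (⋃ i, E i).indicator 1 ω := fun ω => by
    by_cases hω : ω ∈ ⋃ i, E i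
    · rw [Set.indicator_of_mem hω]
      simp only [Pi.one_apply]
      nlinarith [sq_nonneg (1 - C⁻¹ * Z ω)]
    · have hz : Z ω = 0 := Finset.sum_eq_zero fun i _ => by
        rw [Set.indicator_of_notMem fun h => hω (Set.mem_iUnion.2 ⟨i, h⟩), mul_zero]
      rw [Set.indicator_of_notMem hω, hz]
      simp
  have hmain := integral_mono ((hZi.const_mul (2 * C⁻¹)).sub (hZ2i.const_mul (C⁻¹ ^ 2)))
    (hint _ hUm 1) hpt
  rw [hinteg _ hUm, one_mul, integral_sub' (hZi.const_mul _) (hZ2i.const_mul _),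
    integral_const_mul, integral_const_mul, hEZ] at hmain
  have h3 : C⁻¹ ^ 2 * ∫ ω, Z ω ^ 2 ∂law half ≤ C⁻¹ * (p * ∑ i, w i) := by
    calc _ ≤ C⁻¹ ^ 2 * (C * (p * ∑ i, w i)) := by gcongr
      _ = _ := by field_simp
  calc p * (∑ i, w i) / C = 2 * C⁻¹ * (p * ∑ i, w i) - C⁻¹ * (p * ∑ i, w i) := by
        field_simp
        ring
    _ ≤ _ := by linarith

theorem hitProb_eq {F : Set ℝ} (hF : F ⊆ Set.Ici 0) {k n : ℕ} (hk : k = 2 * n) :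
    hitProb F k = law half {ω | ∃ t ∈ F, ones (config k t ω) = n} := by
  refine measure_congr ?_
  filter_upwards [ae_forall_goodSite] with ω hω
  refine propext (exists_congr fun t => and_congr_right fun ht => ?_)
  rw [S_eq_ones hω (hF ht), hk, Nat.mul_div_cancel_left n two_pos]

theorem N_mul_le_hitProb {k n : ℕ} (hn : 0 < n) (hk : k = 2 * n) {F : Set ℝ} {D : ℝ}
    (hF : F ⊆ Set.Icc 0 D) :
    ENNReal.ofReal ((k : ℝ) ^ (-(1 / 2) : ℝ) / (4 * Real.pi * Real.exp D)) * N F (1 / 2) (1 / k) ≤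
      hitProb F k := by
  rw [hitProb_eq (fun t ht => (hF ht).1) hk]
  unfold N
  simp_rw [ENNReal.mul_iSup]
  refine iSup_le fun m => iSup_le fun w => iSup_le fun x => iSup_le fun hp => ?_
  have h := sum_weights_le_law hn hk hF hp
  have hw : 0 ≤ ∑ i, w i := Finset.sum_nonneg fun i _ => hp.2.1 i
  rw [← ENNReal.ofReal_mul (by positivity)]
  calc _ ≤ ENNReal.ofReal ((law half).real (⋃ i, {ω | ones (config k (x i) ω) = n})) := by
        refine ENNReal.ofReal_le_ofReal (le_trans ?_ h)
        have h1 := le_retProb_half hn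
        rw [← hk] at h1
        calc _ = (k : ℝ) ^ (-(1 / 2) : ℝ) / (2 * Real.pi) * (∑ i, w i) / (2 * Real.exp D) := by
              field_simp
              ring
          _ ≤ _ := by gcongr
    _ ≤ _ := by
        rw [ofReal_measureReal]
        exact measure_mono (Set.iUnion_subset fun i ω hω => ⟨x i, hp.1 i, hω⟩)

/-! ### The upper bound on the hitting probability -/

/-- Let `π` be the law of the first hit of `T`, of total mass `h`. Splitting `E t` by an earlier or
simultaneous first hit `s` shows that the part of the potential of `π` at `t` coming from `s ≤ t` is
at most `2 * Real.pi * p`. The part from `s > t` has no pointwise bound, but by symmetry the whole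
energy is at most twice the past half. Markov's inequality then yields a set carrying half of the
mass on which the potential is bounded, that is, a packing after normalization. -/
theorem law_biUnion_le {k n : ℕ} (hn : 0 < n) (hk : k = 2 * n) {F : Set ℝ} (hF : F ⊆ Set.Ici 0)
    (T : Finset ℝ) (hT : ∀ t ∈ T, t ∈ F) :
    law half (⋃ t ∈ T, {ω | ones (config k t ω) = n}) ≤
      ENNReal.ofReal (16 * Real.pi * retProb n (1 / 2)) * N F (1 / 2) (1 / k) := by
  classical
  have hpi := Real.pi_pos
  set p := retProb n (1 / 2) with hpdef
  have hk0 : (0 : ℝ) < k := by exact_mod_cast (by omega : 0 < k)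
  have hp0 : 0 < p := by
    have h := le_retProb_half hn
    rw [← hk] at h
    exact lt_of_lt_of_le (by positivity) h
  set E : ℝ → Set Sample := fun t => {ω | ones (config k t ω) = n} with hE
  have hEm : ∀ t, MeasurableSet (E t) := fun t => measurableSet_ones_config k n t
  set τ : ℝ → Set Sample := fun s =>
    {ω | (∀ u ∈ T.filter (· < s), ones (config k u ω) ≠ n) ∧ ones (config k s ω) = n} with hτ
  have hτE : ∀ s, τ s = (⋂ u ∈ T.filter (· < s), (E u)ᶜ) ∩ E s := fun s => by
    ext ω
    simp [hτ, hE]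
  have hτm : ∀ s, MeasurableSet (τ s) := fun s => by
    rw [hτE]
    exact (Finset.measurableSet_biInter _ fun u _ => (hEm u).compl).inter (hEm s)
  have hdisj : ∀ s ∈ T, ∀ t ∈ T, s ≠ t → Disjoint (τ s) (τ t) := by
    have hlt : ∀ s ∈ T, ∀ t ∈ T, s < t → Disjoint (τ s) (τ t) := fun s hs t ht hst =>
      Set.disjoint_left.2 fun ω h1 h2 => h2.1 s (Finset.mem_filter.2 ⟨hs, hst⟩) h1.2
    intro s hs t ht hst
    rcases lt_or_gt_of_ne hst with h | h
    · exact hlt s hs t ht h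
    · exact (hlt t ht s hs h).symm
  have hcover : ⋃ t ∈ T, E t = ⋃ t ∈ T, τ t := by
    refine Set.Subset.antisymm (fun ω hω => ?_) (Set.iUnion₂_mono fun t _ ω hω => hω.2)
    obtain ⟨t, ht, hω⟩ := Set.mem_iUnion₂.1 hω
    have hne : (T.filter fun u => ω ∈ E u).Nonempty := ⟨t, Finset.mem_filter.2 ⟨ht, hω⟩⟩
    obtain ⟨hs, hsω⟩ := Finset.mem_filter.1 (Finset.min'_mem _ hne)
    refine Set.mem_iUnion₂.2 ⟨_, hs, fun u hu hω' => ?_, hsω⟩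
    obtain ⟨huT, hlt⟩ := Finset.mem_filter.1 hu
    exact absurd (Finset.min'_le _ u (Finset.mem_filter.2 ⟨huT, hω'⟩)) (not_le.2 hlt)
  set π : ℝ → ℝ := fun s => (law half).real (τ s) with hπ
  have hπ0 : ∀ s, 0 ≤ π s := fun s => measureReal_nonneg
  set h : ℝ := ∑ s ∈ T, π s with hh
  have hhE : (law half).real (⋃ t ∈ T, E t) = h := by
    rw [hcover, measureReal_biUnion_finset (fun s hs t ht hst => hdisj s hs t ht hst)
      fun s _ => hτm s]
  set M : ℝ → ℝ → ℝ := fun s t => ψ (1 / 2) ((s - t) / (1 / k)) with hM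
  have hMsymm : ∀ s t, M s t = M t s := fun s t => by
    rw [hM]
    simp only
    rw [← ψ_neg, ← neg_div, neg_sub]
  have hpot : ∀ t ∈ T, ∑ s ∈ T.filter (· ≤ t), π s * M t s ≤ 2 * Real.pi * p := by
    intro t ht
    have ht0 : 0 ≤ t := hF (hT t ht)
    have h1 : ∀ s ∈ T.filter (· ≤ t), π s * M t s ≤ 2 * Real.pi * (law half).real (τ s ∩ E t) := by
      intro s hs
      obtain ⟨hsT, hst⟩ := Finset.mem_filter.1 hs
      have h2 := law_first_hit_inter hk (T.filter (· < s)) (hF (hT s hsT)) hst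
        fun u hu => (Finset.mem_filter.1 hu).2
      have h3 := div_two_pi_le_retProb n (sub_nonneg.2 hst)
      rw [← hk] at h3
      have h4 : (law half).real (τ s ∩ E t) =
          π s * retProb n ((1 - Real.exp (-(2 * (t - s)))) / 2) := by
        rw [measureReal_def, h2, ENNReal.toReal_mul, ENNReal.toReal_ofReal
          ((div_nonneg (ψ_nonneg _ _) (by positivity)).trans h3)]
        rfl
      rw [h4]
      calc π s * M t s = 2 * Real.pi * (π s * (M t s / (2 * Real.pi))) := by
            field_simp
        _ ≤ _ := by
            have := hπ0 s
            gcongr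
    calc _ ≤ ∑ s ∈ T.filter (· ≤ t), 2 * Real.pi * (law half).real (τ s ∩ E t) :=
          Finset.sum_le_sum h1
      _ = 2 * Real.pi * (law half).real (⋃ s ∈ T.filter (· ≤ t), τ s ∩ E t) := by
          rw [← Finset.mul_sum, measureReal_biUnion_finset (fun s hs u hu hsu =>
            (hdisj s (Finset.mem_filter.1 hs).1 u (Finset.mem_filter.1 hu).1 hsu).mono
              Set.inter_subset_left Set.inter_subset_left) fun s _ => (hτm s).inter (hEm t)]
      _ ≤ 2 * Real.pi * (law half).real (E t) := by
          gcongr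
          · exact measure_ne_top _ _
          · exact Set.iUnion₂_subset fun s _ => Set.inter_subset_right
      _ = _ := by
          rw [measureReal_def, law_ones_config hk ht0, ENNReal.toReal_ofReal hp0.le]
  have hhalf : ∑ t ∈ T, π t * ∑ s ∈ T.filter (· ≤ t), π s * M t s ≤ 2 * Real.pi * p * h := by
    rw [hh, Finset.mul_sum]
    refine Finset.sum_le_sum fun t ht => ?_
    rw [mul_comm]
    exact mul_le_mul_of_nonneg_right (hpot t ht) (hπ0 t)
  have hterm : ∀ s t, 0 ≤ π t * (π s * M t s) := fun s t =>
    mul_nonneg (hπ0 t) (mul_nonneg (hπ0 s) (ψ_nonneg _ _))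
  -- Exchanging `s` and `t` turns the past half of the energy into the future half; the diagonal is
  -- counted twice.
  have henergy : ∑ t ∈ T, π t * ∑ s ∈ T, π s * M t s ≤ 4 * Real.pi * p * h := by
    have h1 : ∑ t ∈ T, π t * ∑ s ∈ T.filter (· ≤ t), π s * M t s =
        ∑ t ∈ T, ∑ s ∈ T, if s ≤ t then π t * (π s * M t s) else 0 := by
      refine Finset.sum_congr rfl fun t _ => ?_
      rw [Finset.mul_sum, Finset.sum_filter]
    have h2 : ∑ t ∈ T, π t * ∑ s ∈ T.filter (· ≤ t), π s * M t s =
        ∑ t ∈ T, ∑ s ∈ T, if t ≤ s then π t * (π s * M t s) else 0 := by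
      rw [h1, Finset.sum_comm]
      refine Finset.sum_congr rfl fun t _ => Finset.sum_congr rfl fun s _ => ?_
      rw [hMsymm s t]
      congr 1
      ring
    have h3 : ∑ t ∈ T, π t * ∑ s ∈ T, π s * M t s ≤
        ∑ t ∈ T, π t * ∑ s ∈ T.filter (· ≤ t), π s * M t s +
          ∑ t ∈ T, π t * ∑ s ∈ T.filter (· ≤ t), π s * M t s := by
      nth_rewrite 2 [h2]
      rw [h1, ← Finset.sum_add_distrib]
      refine Finset.sum_le_sum fun t _ => ?_
      rw [← Finset.sum_add_distrib, Finset.mul_sum]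
      refine Finset.sum_le_sum fun s _ => ?_
      have := hterm s t
      rcases le_total s t with hst | hst
      · rw [if_pos hst]
        split_ifs <;> linarith
      · rw [if_pos hst]
        split_ifs <;> linarith
    linarith
  -- Twice the bound `4 * Real.pi * p` on the `π`-average of the potential, so the points above `L`
  -- carry at most half of the mass.
  set L : ℝ := 8 * Real.pi * p with hL
  have hL0 : 0 < L := by positivity
  set A : Finset ℝ := T.filter fun t => ∑ s ∈ T, π s * M t s ≤ L with hA
  have hbad : ∑ t ∈ T.filter (fun t => ¬ ∑ s ∈ T, π s * M t s ≤ L), π t ≤ h / 2 := by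
    have h1 : (∑ t ∈ T.filter (fun t => ¬ ∑ s ∈ T, π s * M t s ≤ L), π t) * L ≤
        4 * Real.pi * p * h := by
      refine le_trans ?_ henergy
      rw [Finset.sum_mul]
      calc _ ≤ ∑ t ∈ T.filter (fun t => ¬ ∑ s ∈ T, π s * M t s ≤ L), π t * ∑ s ∈ T, π s * M t s :=
            Finset.sum_le_sum fun t ht => mul_le_mul_of_nonneg_left
              (not_le.1 (Finset.mem_filter.1 ht).2).le (hπ0 t)
        _ ≤ _ := Finset.sum_le_sum_of_subset_of_nonneg (Finset.filter_subset _ _) fun t _ _ => by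
            rw [Finset.mul_sum]
            exact Finset.sum_nonneg fun s _ => hterm s t
    have h2 : 4 * Real.pi * p * h = h / 2 * L := by
      rw [hL]
      ring
    rw [h2] at h1
    exact le_of_mul_le_mul_right h1 hL0
  have hgood : h / 2 ≤ ∑ t ∈ A, π t := by
    have := Finset.sum_filter_add_sum_filter_not T (fun t => ∑ s ∈ T, π s * M t s ≤ L) π
    linarith
  have hN := ofReal_sum_le_N (F := F) (s := 1 / 2) (r := 1 / k) A
    (fun x hx => hT x (Finset.mem_filter.1 hx).1) (fun t => π t / L)
    (fun t _ => div_nonneg (hπ0 t) hL0.le) fun t ht => by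
      calc ∑ s ∈ A, π s / L * M t s = (∑ s ∈ A, π s * M t s) / L := by
            rw [Finset.sum_div]
            exact Finset.sum_congr rfl fun s _ => by ring
        _ ≤ (∑ s ∈ T, π s * M t s) / L := by
            gcongr
            · exact fun s _ _ => mul_nonneg (hπ0 _) (ψ_nonneg _ _)
            · exact Finset.filter_subset _ _
        _ ≤ 1 := (div_le_one hL0).2 (Finset.mem_filter.1 ht).2
  calc law half (⋃ t ∈ T, E t) = ENNReal.ofReal h := by
        rw [← hhE, ofReal_measureReal (measure_ne_top _ _)]
    _ ≤ ENNReal.ofReal (16 * Real.pi * p * ∑ t ∈ A, π t / L) := by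
        refine ENNReal.ofReal_le_ofReal ?_
        rw [← Finset.sum_div, hL]
        field_simp
        linarith
    _ = ENNReal.ofReal (16 * Real.pi * p) * ENNReal.ofReal (∑ t ∈ A, π t / L) :=
        ENNReal.ofReal_mul (by positivity)
    _ ≤ _ := by gcongr

/-- Every set of reals has a countable subset which is dense in it from the right. -/
theorem exists_countable_right_dense (F : Set ℝ) :
    ∃ D ⊆ F, D.Countable ∧ ∀ t ∈ F, ∃ᶠ u in 𝓝[≥] t, u ∈ D := by
  obtain ⟨c, hcF, hcc, hc⟩ :=
    (TopologicalSpace.IsSeparable.of_separableSpace F).exists_countable_dense_subset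
  -- A dense countable subset can miss points of `F` that are isolated from the right; there are
  -- only countably many of these, and they are added.
  refine ⟨c ∪ {x | x ∈ F ∧ 𝓝[F ∩ Set.Ioi x] x = ⊥}, ?_, ?_, ?_⟩
  · exact Set.union_subset hcF fun x hx => hx.1
  · exact hcc.union countable_setOfPred_isolated_right_within
  · intro t ht
    rw [frequently_iff]
    intro U hU
    by_cases hbot : 𝓝[F ∩ Set.Ioi t] t = ⊥
    · exact ⟨t, mem_of_mem_nhdsWithin (Set.mem_Ici.2 le_rfl) hU, Or.inr ⟨ht, hbot⟩⟩
    · obtain ⟨b, hb, hbU⟩ := (mem_nhdsGE_iff_exists_Ico_subset.1 hU)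
      have hb' : t < b := hb
      have hne : (𝓝[F ∩ Set.Ioi t] t).NeBot := ⟨hbot⟩
      have hmem : Set.Iio b ∩ (F ∩ Set.Ioi t) ∈ 𝓝[F ∩ Set.Ioi t] t :=
        inter_mem (mem_nhdsWithin_of_mem_nhds (Iio_mem_nhds hb')) self_mem_nhdsWithin
      obtain ⟨u, hub, huF, hut⟩ := hne.nonempty_of_mem hmem
      -- Density is used at `u`, strictly to the right of `t`, so that the approximating point also
      -- lies to the right of `t`.
      obtain ⟨v, hv, hvc⟩ := mem_closure_iff_nhds.1 (hc huF) (Set.Ioo t b)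
        (Ioo_mem_nhds hut hub)
      exact ⟨v, hbU ⟨hv.1.le, hv.2⟩, Or.inl hvc⟩

theorem eventually_config_eq {ω : Sample} (h : ∀ i, GoodSite (siteOf i ω)) (k : ℕ) {t : ℝ}
    (ht : 0 ≤ t) : ∀ᶠ u in 𝓝[≥] t, config k u ω = config k t ω := by
  simp_rw [funext_iff]
  refine eventually_all.2 fun i => ?_
  obtain ⟨m, hm⟩ := (h i).exists_rings ht
  filter_upwards [self_mem_nhdsWithin, mem_nhdsWithin_of_mem_nhds (Iio_mem_nhds hm.2)] with u hu hu'
  have hmu : Rings m u (siteOf i ω).2 := ⟨hm.1.trans hu, hu'⟩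
  rw [config, config, (h i).siteState_eq hm, (h i).siteState_eq hmu]

/-- Configurations are right-continuous step functions of time, so almost surely a hit in `F` forces
a hit in a countable subset dense from the right. Continuity from below along its finite subsets
reduces this to `law_biUnion_le`. -/
theorem hitProb_le {k n : ℕ} (hn : 0 < n) (hk : k = 2 * n) {F : Set ℝ} (hF : F ⊆ Set.Ici 0) :
    hitProb F k ≤
      ENNReal.ofReal (32 * Real.pi * (k : ℝ) ^ (-(1 / 2) : ℝ)) * N F (1 / 2) (1 / k) := by
  obtain ⟨D, hDF, hDc, hD⟩ := exists_countable_right_dense F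
  have : Countable D := hDc
  have h1 : hitProb F k ≤ law half (⋃ T : Finset D, ⋃ t ∈ T.map (Function.Embedding.subtype _),
      {ω | ones (config k t ω) = n}) := by
    rw [hitProb_eq hF hk]
    refine measure_mono_ae ?_
    filter_upwards [ae_forall_goodSite] with ω hω
    rintro ⟨t, ht, hωt⟩
    obtain ⟨u, huD, hu⟩ := ((hD t ht).and_eventually (eventually_config_eq hω k (hF ht))).exists
    refine Set.mem_iUnion.2 ⟨{⟨u, huD⟩}, Set.mem_iUnion₂.2 ⟨u, by simp, ?_⟩⟩
    show ones (config k u ω) = n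
    rw [hu, hωt]
  have hdir : Directed (· ⊆ ·) fun T : Finset D =>
      ⋃ t ∈ T.map (Function.Embedding.subtype _), {ω | ones (config k t ω) = n} :=
    Monotone.directed_le fun T T' hTT' =>
      Set.biUnion_subset_biUnion_left (Finset.map_subset_map.2 hTT')
  refine h1.trans ?_
  rw [hdir.measure_iUnion]
  refine iSup_le fun T => ?_
  refine (law_biUnion_le hn hk hF _ fun t ht => ?_).trans ?_
  · obtain ⟨u, -, rfl⟩ := Finset.mem_map.1 ht
    exact hDF u.2
  · have h2 := retProb_half_le hn
    rw [← hk] at h2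
    have := Real.pi_pos
    gcongr ENNReal.ofReal ?_ * _
    nlinarith

end DynBits

/-! ### Monotonicity and size of `N`; the profiles as real numbers. -/

namespace BoxProfile

theorem ψ_anti {s : ℝ} (hs : 0 ≤ s) {x y : ℝ} (hxy : |x| ≤ |y|) : ψ s y ≤ ψ s x := by
  by_cases hx : x = 0
  · rw [hx, ψ_zero]
    exact ψ_le_one s y
  · have hx0 : 0 < |x| := abs_pos.2 hx
    have hy : y ≠ 0 := abs_pos.1 (hx0.trans_le hxy)
    rw [ψ, ψ, if_neg hx, if_neg hy]
    exact min_le_min_left 1 (Real.rpow_le_rpow_of_nonpos hx0 hxy (by linarith))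

theorem N_anti (F : Set ℝ) {s : ℝ} (hs : 0 ≤ s) {r r' : ℝ} (hr : 0 < r) (hrr' : r ≤ r') :
    N F s r' ≤ N F s r := by
  refine iSup_mono fun n => iSup_mono fun w => iSup_mono fun x => iSup_mono' fun hp =>
    ⟨⟨hp.1, hp.2.1, fun i => le_trans (Finset.sum_le_sum fun j _ => ?_) (hp.2.2 i)⟩, le_rfl⟩
  refine mul_le_mul_of_nonneg_left (ψ_anti hs ?_) (hp.2.1 j)
  rw [abs_div, abs_div, abs_of_pos hr, abs_of_pos (hr.trans_le hrr')]
  gcongr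

theorem one_le_N {F : Set ℝ} (hF : F.Nonempty) (s r : ℝ) : 1 ≤ N F s r := by
  obtain ⟨x, hx⟩ := hF
  have := ofReal_sum_le_N (F := F) (s := s) (r := r) {x} (by simpa using hx) (fun _ => 1)
    (by simp) (by simp [ψ_zero])
  simpa using this

theorem N_empty (s r : ℝ) : N ∅ s r = 0 := by
  refine le_antisymm ?_ zero_le
  refine iSup_le fun n => iSup_le fun w => iSup_le fun x => iSup_le fun hp => ?_
  have : IsEmpty (Fin n) := ⟨fun i => hp.1 i⟩
  simp

/-- For `r ≤ 1 / D` all differences divided by `r` are at most `r⁻²`, where the kernel equals `r`.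
The packing condition at a single point then bounds the total weight. This keeps `exponent` at most
`1`, hence the profiles finite. -/
theorem N_le_inv {F : Set ℝ} {D : ℝ} (hD : 1 ≤ D) (hF : F ⊆ Set.Icc 0 D) {r : ℝ} (hr : 0 < r)
    (hrD : r ≤ 1 / D) : N F (1 / 2) r ≤ ENNReal.ofReal (1 / r) := by
  refine iSup_le fun n => iSup_le fun w => iSup_le fun x => iSup_le fun hp =>
    ENNReal.ofReal_le_ofReal ?_
  obtain ⟨hx, hw, hp⟩ := hp
  rcases Nat.eq_zero_or_pos n with h0 | h0
  · subst h0
    simp [hr.le]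
  have hr1 : r ≤ 1 := hrD.trans (by rw [div_le_one (by linarith)]; exact hD)
  have hψ : ∀ j, r ≤ ψ (1 / 2) ((x ⟨0, h0⟩ - x j) / r) := fun j => by
    have h1 := hF (hx ⟨0, h0⟩)
    have h2 := hF (hx j)
    have h3 : |x ⟨0, h0⟩ - x j| ≤ D := by
      rw [abs_le]
      constructor <;> linarith [h1.1, h1.2, h2.1, h2.2]
    have h4 : |(x ⟨0, h0⟩ - x j) / r| ≤ |(r ^ 2)⁻¹| := by
      rw [abs_div, abs_of_pos hr, abs_of_pos (by positivity : 0 < (r ^ 2)⁻¹)]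
      rw [le_div_iff₀ (by linarith)] at hrD
      rw [div_le_iff₀ hr]
      calc |x ⟨0, h0⟩ - x j| ≤ D := h3
        _ ≤ r⁻¹ := by
            rw [← one_div, le_div_iff₀ hr]
            linarith
        _ = _ := by field_simp
    refine le_trans ?_ (ψ_anti (by norm_num) h4)
    rw [ψ, if_neg (by positivity), abs_of_pos (by positivity)]
    refine le_min hr1 (le_of_eq ?_)
    rw [Real.inv_rpow (by positivity), Real.rpow_neg (by positivity), inv_inv,
      ← Real.sqrt_eq_rpow, Real.sqrt_sq hr.le]
  rw [le_div_iff₀ hr, Finset.sum_mul]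
  exact (Finset.sum_le_sum fun j _ => mul_le_mul_of_nonneg_left (hψ j) (hw j)).trans (hp ⟨0, h0⟩)

/-- The exponent whose lower and upper limits at `0` are the box-dimension profiles. -/
noncomputable def exponent (F : Set ℝ) (r : ℝ) : ℝ :=
  Real.log (N F (1 / 2) r).toReal / Real.log (1 / r)

theorem eventually_small {D : ℝ} (hD : 1 ≤ D) : ∀ᶠ r : ℝ in 𝓝[>] 0, 0 < r ∧ r < 1 ∧ r ≤ 1 / D := by
  have h1 : (0 : ℝ) < 1 / D := by positivity
  filter_upwards [self_mem_nhdsWithin, mem_nhdsWithin_of_mem_nhds (Iio_mem_nhds one_pos),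
    mem_nhdsWithin_of_mem_nhds (Iio_mem_nhds h1)] with r h2 h3 h4 using ⟨h2, h3, h4.le⟩

theorem N_toReal_mem {F : Set ℝ} (hne : F.Nonempty) {D : ℝ} (hD : 1 ≤ D) (hF : F ⊆ Set.Icc 0 D)
    {r : ℝ} (hr : 0 < r) :
    N F (1 / 2) r ≠ ⊤ ∧ 1 ≤ (N F (1 / 2) r).toReal := by
  have h1 : N F (1 / 2) r ≠ ⊤ := by
    -- A large scale is first decreased to `1 / D`, which can only increase `N`.
    refine ne_top_of_le_ne_top ?_ (N_anti F (by norm_num)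
      (lt_min hr (by positivity : 0 < 1 / D)) (min_le_left r (1 / D)))
    exact ne_top_of_le_ne_top ENNReal.ofReal_ne_top
      (N_le_inv hD hF (lt_min hr (by positivity)) (min_le_right _ _))
  refine ⟨h1, ?_⟩
  rw [← ENNReal.toReal_one]
  exact ENNReal.toReal_mono h1 (one_le_N hne _ _)

theorem log_N_div {F : Set ℝ} (hne : F.Nonempty) {D : ℝ} (hD : 1 ≤ D) (hF : F ⊆ Set.Icc 0 D)
    {r : ℝ} (hr : 0 < r) :
    ENNReal.log (N F (1 / 2) r) / ((Real.log (1 / r) : ℝ) : EReal) = (exponent F r : ℝ) := by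
  obtain ⟨h1, h2⟩ := N_toReal_mem hne hD hF hr
  rw [ENNReal.log_pos_real' (by linarith), exponent, EReal.coe_div]

theorem exponent_mem {F : Set ℝ} (hne : F.Nonempty) {D : ℝ} (hD : 1 ≤ D) (hF : F ⊆ Set.Icc 0 D)
    {r : ℝ} (hr : 0 < r) (hr1 : r < 1) (hrD : r ≤ 1 / D) :
    0 ≤ exponent F r ∧ exponent F r ≤ 1 := by
  obtain ⟨h1, h2⟩ := N_toReal_mem hne hD hF hr
  have hlog : 0 < Real.log (1 / r) := Real.log_pos (by rw [lt_div_iff₀ hr]; linarith)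
  refine ⟨div_nonneg (Real.log_nonneg h2) hlog.le, (div_le_one hlog).2 ?_⟩
  refine Real.log_le_log (by linarith) ?_
  exact ENNReal.toReal_le_of_le_ofReal (by positivity) (N_le_inv hD hF hr hrD)

theorem exists_lower_eq_coe {F : Set ℝ} (hne : F.Nonempty) {D : ℝ} (hD : 1 ≤ D)
    (hF : F ⊆ Set.Icc 0 D) : ∃ g : ℝ, lower (1 / 2) F = g ∧
      (∀ ε > 0, ∀ᶠ r in 𝓝[>] 0, g - ε < exponent F r) ∧
      ∀ ε > 0, ∃ᶠ r in 𝓝[>] 0, exponent F r < g + ε := by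
  have hev := eventually_small hD
  have h1 : lower (1 / 2) F = liminf (fun r => ((exponent F r : ℝ) : EReal)) (𝓝[>] 0) :=
    liminf_congr (hev.mono fun r hr => log_N_div hne hD hF hr.1)
  have h2 : (0 : EReal) ≤ lower (1 / 2) F := by
    rw [h1]
    refine le_liminf_of_le (by isBoundedDefault) (hev.mono fun r hr => ?_)
    exact_mod_cast (exponent_mem hne hD hF hr.1 hr.2.1 hr.2.2).1
  have h3 : lower (1 / 2) F ≤ (1 : EReal) := by
    rw [h1]
    refine liminf_le_of_frequently_le' (hev.mono fun r hr => ?_).frequently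
    exact_mod_cast (exponent_mem hne hD hF hr.1 hr.2.1 hr.2.2).2
  obtain ⟨g, hg⟩ : ∃ g : ℝ, lower (1 / 2) F = g :=
    ⟨_, (EReal.coe_toReal (ne_top_of_le_ne_top (EReal.coe_ne_top 1) h3)
      (ne_bot_of_le_ne_bot (EReal.coe_ne_bot 0) h2)).symm⟩
  refine ⟨g, hg, fun ε hε => ?_, fun ε hε => ?_⟩
  · have : ((g - ε : ℝ) : EReal) < liminf (fun r => ((exponent F r : ℝ) : EReal)) (𝓝[>] 0) := by
      rw [← h1, hg]
      exact_mod_cast sub_lt_self g hε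
    exact (eventually_lt_of_lt_liminf this).mono fun r hr => by exact_mod_cast hr
  · have : liminf (fun r => ((exponent F r : ℝ) : EReal)) (𝓝[>] 0) < ((g + ε : ℝ) : EReal) := by
      rw [← h1, hg]
      exact_mod_cast lt_add_of_pos_right g hε
    exact (frequently_lt_of_liminf_lt (by isBoundedDefault) this).mono fun r hr => by
      exact_mod_cast hr

theorem exists_upper_eq_coe {F : Set ℝ} (hne : F.Nonempty) {D : ℝ} (hD : 1 ≤ D)
    (hF : F ⊆ Set.Icc 0 D) : ∃ d : ℝ, upper (1 / 2) F = d ∧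
      (∀ ε > 0, ∀ᶠ r in 𝓝[>] 0, exponent F r < d + ε) ∧
      ∀ ε > 0, ∃ᶠ r in 𝓝[>] 0, d - ε < exponent F r := by
  have hev := eventually_small hD
  have h1 : upper (1 / 2) F = limsup (fun r => ((exponent F r : ℝ) : EReal)) (𝓝[>] 0) :=
    limsup_congr (hev.mono fun r hr => log_N_div hne hD hF hr.1)
  have h2 : (0 : EReal) ≤ upper (1 / 2) F := by
    rw [h1]
    refine le_limsup_of_frequently_le' (hev.mono fun r hr => ?_).frequently
    exact_mod_cast (exponent_mem hne hD hF hr.1 hr.2.1 hr.2.2).1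
  have h3 : upper (1 / 2) F ≤ (1 : EReal) := by
    rw [h1]
    refine limsup_le_of_le (by isBoundedDefault) (hev.mono fun r hr => ?_)
    exact_mod_cast (exponent_mem hne hD hF hr.1 hr.2.1 hr.2.2).2
  obtain ⟨d, hd⟩ : ∃ d : ℝ, upper (1 / 2) F = d :=
    ⟨_, (EReal.coe_toReal (ne_top_of_le_ne_top (EReal.coe_ne_top 1) h3)
      (ne_bot_of_le_ne_bot (EReal.coe_ne_bot 0) h2)).symm⟩
  refine ⟨d, hd, fun ε hε => ?_, fun ε hε => ?_⟩
  · have : limsup (fun r => ((exponent F r : ℝ) : EReal)) (𝓝[>] 0) < ((d + ε : ℝ) : EReal) := by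
      rw [← h1, hd]
      exact_mod_cast lt_add_of_pos_right d hε
    exact (eventually_lt_of_limsup_lt this).mono fun r hr => by exact_mod_cast hr
  · have : ((d - ε : ℝ) : EReal) < limsup (fun r => ((exponent F r : ℝ) : EReal)) (𝓝[>] 0) := by
      rw [← h1, hd]
      exact_mod_cast sub_lt_self d hε
    exact (frequently_lt_of_lt_limsup (by isBoundedDefault) this).mono fun r hr => by
      exact_mod_cast hr

theorem lower_empty (s : ℝ) : lower s ∅ = ⊥ := by
  have : lower s ∅ = liminf (fun _ : ℝ => (⊥ : EReal)) (𝓝[>] 0) := by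
    refine liminf_congr ((eventually_small le_rfl).mono fun r hr => ?_)
    rw [N_empty, ENNReal.log_zero]
    refine EReal.bot_div_of_pos_ne_top ?_ (EReal.coe_ne_top _)
    exact_mod_cast Real.log_pos (by rw [lt_div_iff₀ hr.1]; linarith [hr.2.1])
  rw [this, liminf_const]

theorem upper_empty (s : ℝ) : upper s ∅ = ⊥ := by
  have : upper s ∅ = limsup (fun _ : ℝ => (⊥ : EReal)) (𝓝[>] 0) := by
    refine limsup_congr ((eventually_small le_rfl).mono fun r hr => ?_)
    rw [N_empty, ENNReal.log_zero]
    refine EReal.bot_div_of_pos_ne_top ?_ (EReal.coe_ne_top _)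
    exact_mod_cast Real.log_pos (by rw [lt_div_iff₀ hr.1]; linarith [hr.2.1])
  rw [this, limsup_const]

/-! ### Discretization of the scale -/

theorem tendsto_const_div_log (c : ℝ) :
    Tendsto (fun n : ℕ => c / Real.log (2 * n : ℕ)) atTop (𝓝 0) := by
  refine Tendsto.div_atTop tendsto_const_nhds (Real.tendsto_log_atTop.comp
    (tendsto_natCast_atTop_atTop.comp ?_))
  exact tendsto_id.const_mul_atTop' two_pos

theorem tendsto_one_div_two_mul :
    Tendsto (fun n : ℕ => (1 : ℝ) / (2 * n : ℕ)) atTop (𝓝[>] 0) := by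
  refine tendsto_nhdsWithin_iff.2 ⟨Tendsto.div_atTop tendsto_const_nhds
    (tendsto_natCast_atTop_atTop.comp (tendsto_id.const_mul_atTop' two_pos)), ?_⟩
  filter_upwards [eventually_gt_atTop 0] with n hn
  have : (0 : ℝ) < (2 * n : ℕ) := by exact_mod_cast (by omega : 0 < 2 * n)
  exact one_div_pos.2 this

theorem tendsto_floor : Tendsto (fun r : ℝ => ⌊1 / (2 * r)⌋₊) (𝓝[>] 0) atTop := by
  refine tendsto_nat_floor_atTop.comp ?_
  have : (fun r : ℝ => 1 / (2 * r)) = fun r => 2⁻¹ * r⁻¹ := by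
    ext r
    rw [one_div, mul_inv]
  rw [this]
  exact tendsto_inv_nhdsGT_zero.const_mul_atTop (by norm_num)

/-- Rounding `1 / r` down to an even integer coarsens the scale, so `N` does not increase, while `1
/ r < 2(n + 1) ≤ 4n` costs at most `log 2` in the denominator. As `exponent F r ≤ 1`, the loss is at
most `log 2 / log (2n)`. Small exponents thus pass to even integers. -/
theorem exponent_floor_le {F : Set ℝ} (hne : F.Nonempty) {D : ℝ} (hD : 1 ≤ D)
    (hF : F ⊆ Set.Icc 0 D) {r : ℝ} (hr : 0 < r) (hr1 : r < 1) (hrD : r ≤ 1 / D) {n : ℕ}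
    (hn : n = ⌊1 / (2 * r)⌋₊) (hn0 : 0 < n) :
    exponent F (1 / (2 * n : ℕ)) ≤ exponent F r + Real.log 2 / Real.log (2 * n : ℕ) := by
  have hn1 : (1 : ℝ) ≤ n := by exact_mod_cast hn0
  have hle : (n : ℝ) ≤ 1 / (2 * r) := by
    rw [hn]
    exact Nat.floor_le (by positivity)
  have hlt : 1 / (2 * r) < n + 1 := by
    rw [hn]
    exact Nat.lt_floor_add_one _
  rw [le_div_iff₀ (by positivity)] at hle
  rw [div_lt_iff₀ (by positivity)] at hlt
  have hk : ((2 * n : ℕ) : ℝ) = 2 * n := by push_cast; rfl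
  obtain ⟨he0, he1⟩ := exponent_mem hne hD hF hr hr1 hrD
  have hlogr : 0 < Real.log (1 / r) := Real.log_pos (by rw [lt_div_iff₀ hr]; linarith)
  have hlogn : 0 < Real.log (2 * n : ℕ) := Real.log_pos (by rw [hk]; linarith)
  have h1 : Real.log (1 / r) ≤ Real.log 2 + Real.log (2 * n : ℕ) := by
    rw [hk, ← Real.log_mul two_ne_zero (by positivity)]
    refine Real.log_le_log (by positivity) ?_
    rw [div_le_iff₀ hr]
    nlinarith
  have h2 : Real.log (N F (1 / 2) (1 / (2 * n : ℕ))).toReal ≤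
      Real.log (N F (1 / 2) r).toReal := by
    have h3 := N_toReal_mem hne hD hF (r := 1 / (2 * n : ℕ)) (by rw [hk]; positivity)
    refine Real.log_le_log (by linarith) (ENNReal.toReal_mono (N_toReal_mem hne hD hF hr).1 ?_)
    refine N_anti F (by norm_num) hr ?_
    rw [hk, le_div_iff₀ (by positivity)]
    linarith
  have h4 : Real.log (N F (1 / 2) r).toReal = exponent F r * Real.log (1 / r) := by
    rw [exponent]
    field_simp
  rw [exponent, one_div_one_div, div_le_iff₀ hlogn, add_mul, div_mul_cancel₀ _ hlogn.ne']
  nlinarith [Real.log_pos one_lt_two]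

/-- Large exponents require rounding up, which refines the scale. The condition `1 < n` forces `r ≤
1/2`, and then `2n ≤ 2 / r`. -/
theorem le_exponent_floor {F : Set ℝ} (hne : F.Nonempty) {D : ℝ} (hD : 1 ≤ D)
    (hF : F ⊆ Set.Icc 0 D) {r : ℝ} (hr : 0 < r) (hr1 : r < 1) (hrD : r ≤ 1 / D) {n : ℕ}
    (hn : n = ⌊1 / (2 * r)⌋₊ + 1) (hn1 : 1 < n) :
    exponent F r ≤ exponent F (1 / (2 * n : ℕ)) + Real.log 2 / Real.log (2 * n : ℕ) := by
  have hn2 : (2 : ℝ) ≤ n := by exact_mod_cast hn1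
  have hle : (n : ℝ) - 1 ≤ 1 / (2 * r) := by
    rw [hn]
    push_cast
    linarith [Nat.floor_le (by positivity : 0 ≤ 1 / (2 * r))]
  have hlt : 1 / (2 * r) < n := by
    rw [hn]
    push_cast
    exact Nat.lt_floor_add_one _
  rw [le_div_iff₀ (by positivity)] at hle
  rw [div_lt_iff₀ (by positivity)] at hlt
  have hk : ((2 * n : ℕ) : ℝ) = 2 * n := by push_cast; rfl
  obtain ⟨he0, he1⟩ := exponent_mem hne hD hF hr hr1 hrD
  have hlogr : 0 < Real.log (1 / r) := Real.log_pos (by rw [lt_div_iff₀ hr]; linarith)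
  have hlogn : 0 < Real.log (2 * n : ℕ) := Real.log_pos (by rw [hk]; linarith)
  have h1 : Real.log (2 * n : ℕ) ≤ Real.log 2 + Real.log (1 / r) := by
    rw [hk, ← Real.log_mul two_ne_zero (by positivity)]
    refine Real.log_le_log (by positivity) ?_
    rw [mul_one_div, le_div_iff₀ hr]
    nlinarith
  have h2 : Real.log (N F (1 / 2) r).toReal ≤
      Real.log (N F (1 / 2) (1 / (2 * n : ℕ))).toReal := by
    have h3 := N_toReal_mem hne hD hF (r := 1 / (2 * n : ℕ)) (by rw [hk]; positivity)
    refine Real.log_le_log (by linarith [(N_toReal_mem hne hD hF hr).2])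
      (ENNReal.toReal_mono h3.1 ?_)
    refine N_anti F (by norm_num) (by rw [hk]; positivity) ?_
    rw [hk, div_le_iff₀ (by positivity)]
    linarith
  have h4 : Real.log (N F (1 / 2) r).toReal = exponent F r * Real.log (1 / r) := by
    rw [exponent]
    field_simp
  rw [exponent.eq_1 F (1 / (2 * n : ℕ)), one_div_one_div, ← add_div, le_div_iff₀ hlogn]
  nlinarith [Real.log_pos one_lt_two]

theorem frequently_exponent_lt {F : Set ℝ} (hne : F.Nonempty) {D : ℝ} (hD : 1 ≤ D)
    (hF : F ⊆ Set.Icc 0 D) {g : ℝ} (hg : ∀ ε > 0, ∃ᶠ r in 𝓝[>] 0, exponent F r < g + ε)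
    {ε : ℝ} (hε : 0 < ε) : ∃ᶠ n : ℕ in atTop, exponent F (1 / (2 * n : ℕ)) < g + ε := by
  have h1 : ∀ᶠ n : ℕ in atTop, Real.log 2 / Real.log (2 * n : ℕ) < ε / 2 :=
    (tendsto_const_div_log _).eventually_lt_const (by positivity)
  refine tendsto_floor.frequently (((hg (ε / 2) (by positivity)).and_eventually
    ((eventually_small hD).and ((tendsto_floor.eventually h1).and
      (tendsto_floor.eventually (eventually_gt_atTop 0))))).mono ?_)
  rintro r ⟨h2, h3, h4, h5⟩
  linarith [exponent_floor_le hne hD hF h3.1 h3.2.1 h3.2.2 rfl h5]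

theorem frequently_lt_exponent {F : Set ℝ} (hne : F.Nonempty) {D : ℝ} (hD : 1 ≤ D)
    (hF : F ⊆ Set.Icc 0 D) {d : ℝ} (hd : ∀ ε > 0, ∃ᶠ r in 𝓝[>] 0, d - ε < exponent F r)
    {ε : ℝ} (hε : 0 < ε) : ∃ᶠ n : ℕ in atTop, d - ε < exponent F (1 / (2 * n : ℕ)) := by
  have h1 : ∀ᶠ n : ℕ in atTop, Real.log 2 / Real.log (2 * n : ℕ) < ε / 2 :=
    (tendsto_const_div_log _).eventually_lt_const (by positivity)
  have ht : Tendsto (fun r : ℝ => ⌊1 / (2 * r)⌋₊ + 1) (𝓝[>] 0) atTop :=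
    (tendsto_add_atTop_nat 1).comp tendsto_floor
  refine ht.frequently (((hd (ε / 2) (by positivity)).and_eventually
    ((eventually_small hD).and ((ht.eventually h1).and
      (ht.eventually (eventually_gt_atTop 1))))).mono ?_)
  rintro r ⟨h2, h3, h4, h5⟩
  linarith [le_exponent_floor hne hD hF h3.1 h3.2.1 h3.2.2 rfl h5]

end BoxProfile

/-! ### Sequences with prescribed lower limit -/

theorem exists_tendsto_zero_add_le {u : ℕ → ℝ} {g : ℝ}
    (h : ∀ ε > 0, ∀ᶠ n in atTop, g - ε < u n) :
    ∃ η : ℕ → ℝ, Tendsto η atTop (𝓝 0) ∧ ∀ n, g + η n ≤ u n := by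
  -- The negative part of `u - g`: it tends to zero even if `u` itself does not converge.
  refine ⟨fun n => min 0 (u n - g), ?_, fun n => by linarith [min_le_right 0 (u n - g)]⟩
  refine Metric.tendsto_nhds.2 fun ε hε => (h ε hε).mono fun n hn => ?_
  rw [Real.dist_eq, sub_zero, abs_of_nonpos (min_le_left _ _)]
  rcases min_choice 0 (u n - g) with h0 | h0 <;> rw [h0] <;> linarith

theorem exists_strictMono_tendsto {u : ℕ → ℝ} {g : ℝ}
    (h : ∀ ε > 0, ∀ᶠ n in atTop, g - ε < u n) (h' : ∀ ε > 0, ∃ᶠ n in atTop, u n < g + ε) :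
    ∃ φ : ℕ → ℕ, StrictMono φ ∧ (∀ n, 1 ≤ φ n) ∧ Tendsto (fun n => u (φ n)) atTop (𝓝 g) := by
  have hpos : ∀ n : ℕ, (0 : ℝ) < 1 / (n + 1) := fun n => Nat.one_div_pos_of_nat
  obtain ⟨φ, hφ, hφ'⟩ := extraction_forall_of_frequently (P := fun n k =>
      u k < g + 1 / (n + 1) ∧ g - 1 / (n + 1) < u k ∧ 1 ≤ k) fun n =>
    (h' _ (hpos n)).and_eventually ((h _ (hpos n)).and (eventually_ge_atTop 1))
  refine ⟨φ, hφ, fun n => (hφ' n).2.2, ?_⟩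
  refine tendsto_iff_dist_tendsto_zero.2 (squeeze_zero (fun _ => dist_nonneg) (fun n => ?_)
    (tendsto_one_div_add_atTop_nhds_zero_nat (𝕜 := ℝ)))
  rw [Real.dist_eq, abs_le]
  constructor <;> linarith [(hφ' n).1, (hφ' n).2.1]

/-! ### The exponent of the hitting probability. -/

namespace DynBits

open BoxProfile

/-- The exponent of the hitting probability for `2n` sites. -/
noncomputable def hitExponent (F : Set ℝ) (n : ℕ) : ℝ :=
  Real.log (hitProb F (2 * n)).toReal / Real.log (2 * n : ℕ)

theorem hitProb_ne_top (F : Set ℝ) (k : ℕ) : hitProb F k ≠ ⊤ := measure_ne_top _ _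

theorem hitProb_toReal_bounds {F : Set ℝ} (hne : F.Nonempty) {D : ℝ} (hD : 1 ≤ D)
    (hF : F ⊆ Set.Icc 0 D) {n : ℕ} (hn : 0 < n) :
    ((2 * n : ℕ) : ℝ) ^ (-(1 / 2) : ℝ) / (4 * Real.pi * Real.exp D) *
        (N F (1 / 2) (1 / (2 * n : ℕ))).toReal ≤ (hitProb F (2 * n)).toReal ∧
      (hitProb F (2 * n)).toReal ≤ 32 * Real.pi * ((2 * n : ℕ) : ℝ) ^ (-(1 / 2) : ℝ) *
        (N F (1 / 2) (1 / (2 * n : ℕ))).toReal := by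
  have hk : (0 : ℝ) < (2 * n : ℕ) := by exact_mod_cast (by omega : 0 < 2 * n)
  have hpi := Real.pi_pos
  have hN := (N_toReal_mem hne hD hF (one_div_pos.2 hk)).1
  have h1 := ENNReal.toReal_mono (hitProb_ne_top F (2 * n)) (N_mul_le_hitProb hn rfl hF)
  have h2 := ENNReal.toReal_mono (ENNReal.mul_ne_top ENNReal.ofReal_ne_top hN)
    (hitProb_le hn rfl fun t ht => (hF ht).1)
  rw [ENNReal.toReal_mul, ENNReal.toReal_ofReal (by positivity)] at h1 h2
  exact ⟨h1, h2⟩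

theorem hitProb_toReal_pos {F : Set ℝ} (hne : F.Nonempty) {D : ℝ} (hD : 1 ≤ D)
    (hF : F ⊆ Set.Icc 0 D) {n : ℕ} (hn : 0 < n) : 0 < (hitProb F (2 * n)).toReal := by
  have hk : (0 : ℝ) < (2 * n : ℕ) := by exact_mod_cast (by omega : 0 < 2 * n)
  have hN := (N_toReal_mem hne hD hF (one_div_pos.2 hk)).2
  have hN0 : 0 < (N F (1 / 2) (1 / (2 * n : ℕ))).toReal := by linarith
  have hpi := Real.pi_pos
  exact lt_of_lt_of_le (by positivity) (hitProb_toReal_bounds hne hD hF hn).1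

/-- Both bounds on the hitting probability are constants times `k ^ (-1/2) * N`, and a constant
contributes only `O(1 / log k)` to the exponent. -/
theorem tendsto_hitExponent_sub {F : Set ℝ} (hne : F.Nonempty) {D : ℝ} (hD : 1 ≤ D)
    (hF : F ⊆ Set.Icc 0 D) :
    Tendsto (fun n : ℕ => hitExponent F n + 1 / 2 - exponent F (1 / (2 * n : ℕ))) atTop (𝓝 0) := by
  have hpi := Real.pi_pos
  refine tendsto_of_tendsto_of_tendsto_of_le_of_le'
    (tendsto_const_div_log (Real.log (1 / (4 * Real.pi * Real.exp D))))
    (tendsto_const_div_log (Real.log (32 * Real.pi))) ?_ ?_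
  all_goals
    filter_upwards [eventually_gt_atTop 0] with n hn
    have hk : (0 : ℝ) < (2 * n : ℕ) := by exact_mod_cast (by omega : 0 < 2 * n)
    have hlog : 0 < Real.log (2 * n : ℕ) :=
      Real.log_pos (by exact_mod_cast (by omega : 1 < 2 * n))
    have hN := (N_toReal_mem hne hD hF (one_div_pos.2 hk)).2
    have hN0 : 0 < (N F (1 / 2) (1 / (2 * n : ℕ))).toReal := by linarith
    obtain ⟨h1, h2⟩ := hitProb_toReal_bounds hne hD hF hn
    have hP := hitProb_toReal_pos hne hD hF hn
    have hkp : 0 < ((2 * n : ℕ) : ℝ) ^ (-(1 / 2) : ℝ) := Real.rpow_pos_of_pos hk _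
    have heq : hitExponent F n + 1 / 2 - exponent F (1 / (2 * n : ℕ)) =
        (Real.log (hitProb F (2 * n)).toReal + 1 / 2 * Real.log (2 * n : ℕ) -
          Real.log (N F (1 / 2) (1 / (2 * n : ℕ))).toReal) / Real.log (2 * n : ℕ) := by
      rw [hitExponent, exponent, one_div_one_div]
      field_simp
    rw [heq]
    refine div_le_div_of_nonneg_right ?_ hlog.le
  · have h3 := Real.log_le_log (by positivity) h1
    rw [Real.log_mul (by positivity) hN0.ne', div_eq_mul_one_div, Real.log_mul hkp.ne'
      (by positivity), Real.log_rpow hk] at h3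
    linarith
  · have h3 := Real.log_le_log hP h2
    rw [Real.log_mul (by positivity) hN0.ne', Real.log_mul (by positivity) hkp.ne',
      Real.log_rpow hk] at h3
    linarith

theorem hitProb_eq_powE {F : Set ℝ} (hne : F.Nonempty) {D : ℝ} (hD : 1 ≤ D)
    (hF : F ⊆ Set.Icc 0 D) {n : ℕ} (hn : 0 < n) :
    hitProb F (2 * n) = powE (2 * n) (hitExponent F n : ℝ) := by
  have hk : (0 : ℝ) < (2 * n : ℕ) := by exact_mod_cast (by omega : 0 < 2 * n)
  have hlog : 0 < Real.log (2 * n : ℕ) :=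
    Real.log_pos (by exact_mod_cast (by omega : 1 < 2 * n))
  rw [powE_coe (by omega), Real.rpow_def_of_pos hk, hitExponent, mul_div_cancel₀ _ hlog.ne',
    Real.exp_log (hitProb_toReal_pos hne hD hF hn), ENNReal.ofReal_toReal (hitProb_ne_top F _)]

end DynBits

/-! ### Extended exponents and assembly of the theorem. -/

theorem powE_mono {k : ℕ} (hk : 0 < k) {x y : ℝ} (hxy : x ≤ y) : powE k x ≤ powE k y := by
  rw [powE_coe hk, powE_coe hk]
  exact ENNReal.ofReal_le_ofReal (Real.rpow_le_rpow_of_exponent_le (by exact_mod_cast hk) hxy)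

theorem neg_one_sub_two_mul_coe (g ε : ℝ) :
    -(1 - 2 * (g : EReal)) / 2 + (ε : EReal) = ((g + ε - 1 / 2 : ℝ) : EReal) := by
  have : (g + ε - 1 / 2 : ℝ) = -(1 - 2 * g) / 2 + ε := by ring
  rw [this]
  push_cast
  rfl

/-- The exponent collapses to `⊥`; `2 ≤ k` makes `log k` positive, so that the product stays `⊥`
instead of becoming `⊥ * 0 = 0`. -/
theorem powE_bot_exponent {k : ℕ} (hk : 2 ≤ k) (ε : ℝ) :
    powE k (-(1 - 2 * (⊥ : EReal)) / 2 + (ε : EReal)) = 0 := by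
  have h1 : (2 : EReal) * ⊥ = ⊥ := EReal.mul_bot_of_pos (by norm_num)
  have h2 : (1 : EReal) - ⊥ = ⊤ := EReal.coe_sub_bot 1
  have h3 : (⊥ : EReal) / 2 = ⊥ :=
    EReal.bot_div_of_pos_ne_top (by norm_num) (EReal.coe_ne_top 2)
  have hlog : 0 < Real.log k := Real.log_pos (by exact_mod_cast hk)
  rw [h1, h2, EReal.neg_top, h3, EReal.bot_add, powE, EReal.bot_mul_coe_of_pos hlog, EReal.exp_bot]

theorem theorem1p3 (F : Set ℝ) (hF_nonneg : F ⊆ Set.Ici 0) (hF_bdd : Bornology.IsBounded F)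
    (γ δ : EReal) (hγ : γ = BoxProfile.lower (1 / 2) F) (hδ : δ = BoxProfile.upper (1 / 2) F) :
    -- the lower bound
    (∃ ε : ℕ → ℝ, Tendsto ε atTop (𝓝 0) ∧
      ∀ k : ℕ, Even k → 2 ≤ k → powE k (-(1 - 2 * γ) / 2 + ε k) ≤ DynBits.hitProb F k) ∧
    -- the upper bound
    (∃ ε : ℕ → ℝ, Tendsto ε atTop (𝓝 0) ∧
      ∀ k : ℕ, Even k → 2 ≤ k → DynBits.hitProb F k ≤ powE k (-(1 - 2 * δ) / 2 + ε k)) ∧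
    -- the lower bound is attained along a subsequence
    (∃ κ : ℕ → ℕ, StrictMono κ ∧ (∀ n, Even (κ n) ∧ 2 ≤ κ n) ∧
      ∃ ε : ℕ → ℝ, Tendsto ε atTop (𝓝 0) ∧
        ∀ n, DynBits.hitProb F (κ n) = powE (κ n) (-(1 - 2 * γ) / 2 + ε n)) ∧
    -- the upper bound is attained along a subsequence
    (∃ κ : ℕ → ℕ, StrictMono κ ∧ (∀ n, Even (κ n) ∧ 2 ≤ κ n) ∧
      ∃ ε : ℕ → ℝ, Tendsto ε atTop (𝓝 0) ∧
        ∀ n, DynBits.hitProb F (κ n) = powE (κ n) (-(1 - 2 * δ) / 2 + ε n)) := by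
  rcases F.eq_empty_or_nonempty with rfl | hne
  · have hP : ∀ k, DynBits.hitProb ∅ k = 0 := fun k => by simp [DynBits.hitProb]
    rw [BoxProfile.lower_empty] at hγ
    rw [BoxProfile.upper_empty] at hδ
    have hκ : StrictMono fun n : ℕ => 2 * (n + 1) := fun a b hab => by
      show 2 * (a + 1) < 2 * (b + 1)
      omega
    have hκ' : ∀ n : ℕ, Even (2 * (n + 1)) ∧ 2 ≤ 2 * (n + 1) := fun n =>
      ⟨even_two_mul _, by omega⟩
    subst hγ hδ
    refine ⟨⟨fun _ => 0, tendsto_const_nhds, fun k _ hk => ?_⟩,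
      ⟨fun _ => 0, tendsto_const_nhds, fun k _ hk => ?_⟩,
      ⟨_, hκ, hκ', fun _ => 0, tendsto_const_nhds, fun n => ?_⟩,
      ⟨_, hκ, hκ', fun _ => 0, tendsto_const_nhds, fun n => ?_⟩⟩
    · rw [powE_bot_exponent hk]
      exact zero_le
    · rw [hP]
      exact zero_le
    · rw [hP, powE_bot_exponent (hκ' n).2]
    · rw [hP, powE_bot_exponent (hκ' n).2]
  obtain ⟨D₀, hD₀⟩ := hF_bdd.subset_closedBall 0
  -- The bound `N_le_inv` needs a diameter bound of at least `1`.
  set D := max 1 D₀ with hDdef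
  have hD : 1 ≤ D := le_max_left _ _
  have hF : F ⊆ Set.Icc 0 D := fun t ht => by
    refine ⟨hF_nonneg ht, ?_⟩
    have h1 := hD₀ ht
    rw [Metric.mem_closedBall, Real.dist_eq, sub_zero] at h1
    exact (le_abs_self t).trans (h1.trans (le_max_right _ _))
  obtain ⟨g, hg, hg1, hg2⟩ := BoxProfile.exists_lower_eq_coe hne hD hF
  obtain ⟨d, hd, hd1, hd2⟩ := BoxProfile.exists_upper_eq_coe hne hD hF
  rw [hg] at hγ
  rw [hd] at hδ
  subst hγ hδ
  -- With the shift by `1/2`, `u n` is asymptotic to `exponent F (1 / (2 * n))`, so its lower and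
  -- upper limits are `g` and `d`.
  set u : ℕ → ℝ := fun n => DynBits.hitExponent F n + 1 / 2 with hu
  have hlim := DynBits.tendsto_hitExponent_sub hne hD hF
  have hsmall : ∀ ε > 0, ∀ᶠ n : ℕ in atTop,
      |u n - BoxProfile.exponent F (1 / (2 * n : ℕ))| < ε := fun ε hε => by
    refine (Metric.tendsto_nhds.1 hlim ε hε).mono fun n hn => ?_
    rwa [Real.dist_eq, sub_zero] at hn
  have hlow : ∀ ε > 0, ∀ᶠ n in atTop, g - ε < u n := fun ε hε => by
    filter_upwards [hsmall (ε / 2) (by positivity),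
      BoxProfile.tendsto_one_div_two_mul.eventually (hg1 (ε / 2) (by positivity))] with n h1 h2
    linarith [(abs_lt.1 h1).1]
  have hlow' : ∀ ε > 0, ∃ᶠ n in atTop, u n < g + ε := fun ε hε => by
    refine ((BoxProfile.frequently_exponent_lt hne hD hF hg2 (half_pos hε)).and_eventually
      (hsmall (ε / 2) (by positivity))).mono fun n h => ?_
    linarith [(abs_lt.1 h.2).2, h.1]
  -- The upper limit of `u` is handled as the lower limit of `-u`, so the same two sequence lemmas
  -- serve both bounds.
  have hup : ∀ ε > 0, ∀ᶠ n in atTop, -d - ε < -u n := fun ε hε => by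
    filter_upwards [hsmall (ε / 2) (by positivity),
      BoxProfile.tendsto_one_div_two_mul.eventually (hd1 (ε / 2) (by positivity))] with n h1 h2
    linarith [(abs_lt.1 h1).2]
  have hup' : ∀ ε > 0, ∃ᶠ n in atTop, -u n < -d + ε := fun ε hε => by
    refine ((BoxProfile.frequently_lt_exponent hne hD hF hd2 (half_pos hε)).and_eventually
      (hsmall (ε / 2) (by positivity))).mono fun n h => ?_
    linarith [(abs_lt.1 h.2).1, h.1]
  have hhalf : Tendsto (fun k : ℕ => k / 2) atTop atTop := Nat.tendsto_div_const_atTop two_ne_zero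
  have hPu : ∀ n, 0 < n → DynBits.hitProb F (2 * n) = powE (2 * n) ((u n - 1 / 2 : ℝ) : EReal) :=
    fun n hn => by
      rw [DynBits.hitProb_eq_powE hne hD hF hn, hu]
      congr 2
      ring
  refine ⟨?_, ?_, ?_, ?_⟩
  · obtain ⟨η, hη, hle⟩ := exists_tendsto_zero_add_le hlow
    refine ⟨fun k => η (k / 2), hη.comp hhalf, fun k hk hk2 => ?_⟩
    obtain ⟨n, rfl⟩ := even_iff_exists_two_mul.1 hk
    simp only [Nat.mul_div_cancel_left n two_pos]
    rw [neg_one_sub_two_mul_coe, hPu n (by omega)]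
    exact powE_mono (by omega) (by linarith [hle n])
  · obtain ⟨η, hη, hle⟩ := exists_tendsto_zero_add_le hup
    refine ⟨fun k => -η (k / 2), by simpa using (hη.comp hhalf).neg, fun k hk hk2 => ?_⟩
    obtain ⟨n, rfl⟩ := even_iff_exists_two_mul.1 hk
    simp only [Nat.mul_div_cancel_left n two_pos]
    rw [neg_one_sub_two_mul_coe, hPu n (by omega)]
    exact powE_mono (by omega) (by linarith [hle n])
  · obtain ⟨φ, hφ, hφ1, hlimφ⟩ := exists_strictMono_tendsto hlow hlow'
    refine ⟨fun n => 2 * φ n, hφ.const_mul two_pos,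
      fun n => ⟨even_two_mul _, Nat.mul_le_mul_left 2 (hφ1 n)⟩, fun n => u (φ n) - g, ?_, fun n => ?_⟩
    · simpa using hlimφ.sub_const g
    · rw [hPu _ (hφ1 n), neg_one_sub_two_mul_coe]
      congr 2
      ring
  · obtain ⟨φ, hφ, hφ1, hlimφ⟩ := exists_strictMono_tendsto hup hup'
    refine ⟨fun n => 2 * φ n, hφ.const_mul two_pos,
      fun n => ⟨even_two_mul _, Nat.mul_le_mul_left 2 (hφ1 n)⟩, fun n => u (φ n) - d, ?_, fun n => ?_⟩
    · simpa using hlimφ.neg.sub_const d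
    · rw [hPu _ (hφ1 n), neg_one_sub_two_mul_coe]
      congr 2
      ring
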